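/- Let $\rho\in[-1,1]$. A sequence of random real matrices $\mathbf X_n=(X_{ij})_{i,j=1}^n$, $n\ge 1$, on a common probability space $(\Omega,\mathcal F,\mathbb P)$ is said to satisfy condition (C0) with correlation $\rho$ if the laws of the entries do not depend on $n$ and, for every $n$, a) the pairs $(X_{ij},X_{ji})$, $1\le i<j\le n$, are independent and identically distributed random vectors; b) $\mathbb E X_{12}=\mathbb E X_{21}=0$, $\mathbb E X_{12}^2=\mathbb E X_{21}^2=1$ and $\max(\mathbb E|X_{12}|^4,\mathbb E|X_{21}|^4)\le M_4$ for some finite constant $M_4$; c) $\mathbb E(X_{12}X_{21})=\rho$; d) the diagonal entries $X_{ii}$ are i.i.d. and independent of the off-diagonal entries, with $\mathbb E X_{11}=0$ and $\mathbb E X_{11}^2<\infty$. For $z\in\mathbb C$ let $s_1\ge\dots\ge s_n\ge 0$ be the singular values of $n^{-1/2}\mathbf X_n-z\mathbf I$, and let $$\mathcal F_n(x,z)=\frac1n\,\#\{1\le i\le n:\ s_i\le x\},\qquad x\in\mathbb R,$$ be their empirical distribution function. **Theorem.** For every $\rho\in[-1,1]$ there is a family of non-random distribution functions $\mathcal F(\cdot,z)$,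 $z\in\mathbb C$, depending only on $\rho$ and $z$ (and not on the distribution of the entries), such that for every sequence $\mathbf X_n$ satisfying (C0) with correlation $\rho$, for almost all $z\in\mathbb C$ (with respect to Lebesgue measure), for all bounded continuous functions $f:\mathbb R\to\mathbb C$ and all $\varepsilon>0$, $$\mathbb P\left(\left|\int_{\mathbb R} f(x)\,d\mathcal F_n(x,z)-\int_{\mathbb R} f(x)\,d\mathcal F(x,z)\right|>\varepsilon\right)\longrightarrow 0\qquad (n\to\infty).$$ -/

import Mathlib

open MeasureTheory ProbabilityTheory Filter Topology
open scoped BoundedContinuousFunction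

/-- Condition (C0) for a sequence of random real `n × n` matrices `X n = (X n i j)`, defined on one
probability space, whose entry laws do not depend on `n`.  The pairs `(X i j, X j i)` are indexed
by the unordered off-diagonal positions, that is by `i < j`; no exchangeability inside a pair is
assumed. -/
structure ConditionC0 {Ω : Type*} [MeasurableSpace Ω] (P : Measure Ω) (ρ M₄ : ℝ)
    (X : (n : ℕ) → Fin n → Fin n → Ω → ℝ) : Prop where
  /-- the entries are random variables -/
  measurable : ∀ n i j, Measurable (X n i j)
  /-- the off-diagonal pairs are independent -/
  indep_pairs : ∀ n, iIndepFun
    (fun (p : {p : Fin n × Fin n // p.1 < p.2}) (ω : Ω) =>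
      (X n p.1.1 p.1.2 ω, X n p.1.2 p.1.1 ω)) P
  /-- the off-diagonal pairs are identically distributed -/
  ident_pairs : ∀ n m (i j : Fin n) (k l : Fin m), i < j → k < l →
    IdentDistrib (fun ω => (X n i j ω, X n j i ω)) (fun ω => (X m k l ω, X m l k ω)) P P
  /-- off-diagonal entries have finite fourth moment -/
  memLp_offDiag : ∀ n (i j : Fin n), i ≠ j → MemLp (X n i j) 4 P
  mean_offDiag : ∀ n (i j : Fin n), i ≠ j → ∫ ω, X n i j ω ∂P = 0
  variance_offDiag : ∀ n (i j : Fin n), i ≠ j → ∫ ω, X n i j ω ^ 2 ∂P = 1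
  fourth_moment_offDiag : ∀ n (i j : Fin n), i ≠ j → ∫ ω, |X n i j ω| ^ 4 ∂P ≤ M₄
  correlation : ∀ n (i j : Fin n), i ≠ j → ∫ ω, X n i j ω * X n j i ω ∂P = ρ
  /-- the diagonal entries are independent -/
  indep_diag : ∀ n, iIndepFun (fun (i : Fin n) => X n i i) P
  /-- the diagonal entries are identically distributed -/
  ident_diag : ∀ n m (i : Fin n) (k : Fin m), IdentDistrib (X n i i) (X m k k) P P
  /-- the diagonal is independent of the off-diagonal part -/
  indep_diag_offDiag : ∀ n, IndepFun
    (fun (ω : Ω) (i : Fin n) => X n i i ω)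
    (fun (ω : Ω) (p : {p : Fin n × Fin n // p.1 ≠ p.2}) => X n p.1.1 p.1.2 ω) P
  /-- diagonal entries have finite second moment -/
  memLp_diag : ∀ n (i : Fin n), MemLp (X n i i) 2 P
  mean_diag : ∀ n (i : Fin n), ∫ ω, X n i i ω ∂P = 0

/-- The complex matrix `n^{-1/2} A - z I`. -/
noncomputable def shiftedMatrix {n : ℕ} (A : Matrix (Fin n) (Fin n) ℝ) (z : ℂ) :
    Matrix (Fin n) (Fin n) ℂ :=
  ((Real.sqrt n)⁻¹ • A).map Complex.ofReal - z • (1 : Matrix (Fin n) (Fin n) ℂ)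

/-- The empirical measure `n⁻¹ ∑ δ_{s_i(B)}` of the `n` singular values, counted with
multiplicity, of an `n × n` complex matrix `B`. -/
noncomputable def singularValueMeasure {n : ℕ} (B : Matrix (Fin n) (Fin n) ℂ) : Measure ℝ :=
  (n : ENNReal)⁻¹ •
    ∑ i : Fin n, Measure.dirac ((Matrix.toEuclideanLin B).singularValues i)

/-- `F` is the distribution function of a probability measure on `ℝ`
(monotone and right-continuous by its type). -/
def IsDistributionFunction (F : StieltjesFunction ℝ) : Prop :=
  Tendsto F atBot (𝓝 0) ∧ Tendsto F atTop (𝓝 1)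

/-!
The Hermitization of `n^{-1/2} A - z` has a resolvent `R` at the spectral parameter `i v`, and the
normalized traces `g a b` of its four `n × n` blocks (`a b : Bool`) satisfy, up to a small error,
the Dyson equation
`δ_ab + z_a g_{!a,b} + i v g_ab + g_{!a,!a} g_ab + ρ g_{!a,a} g_{!a,b} = 0`.
To bound the second moment of the error `D`, write `|D|² = D · conj D` and expand one factor over
the matrix entries. In the term of a pair `(i, j)`, replace the matrix by the one in which `A i j`
and `A j i` are erased. The erased matrix is independent of that pair, so a second-order resolvent
expansion leaves only the correlation `ρ`, which the equation accounts for, and errors that sum up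
to `O(n^{-1/2})`; the other factor `conj D` also moves little, which is why no separate
concentration estimate is needed.

For `v ≥ 2 (‖z‖ + 4)` the Dyson equation is contractive on the matrices of norm at most `1`, so it
has a unique solution there and `g` converges to it in probability. Since a diagonal block trace is
`i v ∫ (x² + v²)⁻¹ dμ_n`, where `μ_n` is the law of the singular values, the transforms
`t ↦ ∫ (x² + t)⁻¹ dμ_n` converge for all large `t`. Such a transform determines a
law on `[0, ∞)`; together with tightness, which follows from a bound on the second moment, this
gives weak convergence in probability for every `z`.
-/

open scoped NNReal ENNReal ComplexConjugate

section ResolventTransform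

/-- The bounded continuous function `x ↦ (x² + t)⁻¹` on `[0, ∞)`. -/
noncomputable def invSqTest (t : ℝ) (ht : 0 < t) : ℝ≥0 →ᵇ ℝ :=
  BoundedContinuousFunction.ofNormedAddCommGroup (fun x => ((x : ℝ) ^ 2 + t)⁻¹)
    (Continuous.inv₀ (by fun_prop) (fun x => by positivity)) t⁻¹
    (fun x => by
      rw [Real.norm_of_nonneg (by positivity)]
      exact inv_anti₀ ht (by nlinarith [sq_nonneg (x : ℝ)]))

@[simp] theorem invSqTest_apply (t : ℝ) (ht : 0 < t) (x : ℝ≥0) :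
    invSqTest t ht x = ((x : ℝ) ^ 2 + t)⁻¹ := rfl

theorem invSqTest_injective {t : ℝ} (ht : 0 < t) : Function.Injective (invSqTest t ht) := by
  intro x y hxy
  have hsq : (x : ℝ) ^ 2 = (y : ℝ) ^ 2 := add_right_cancel (inv_injective hxy)
  exact NNReal.coe_injective ((sq_eq_sq₀ x.2 y.2).1 hsq)

theorem integrable_inv_sq_add_pow (μ : Measure ℝ≥0) [IsFiniteMeasure μ] {t : ℝ} (ht : 0 < t)
    (k : ℕ) : Integrable (fun x : ℝ≥0 => ((x : ℝ) ^ 2 + t)⁻¹ ^ k) μ :=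
  ((invSqTest t ht ^ k).integrable μ).congr (Eventually.of_forall fun x => by simp)

theorem hasDerivAt_inv_add_pow {a t : ℝ} (h : a + t ≠ 0) (k : ℕ) :
    HasDerivAt (fun t => (a + t)⁻¹ ^ k) (-k * (a + t)⁻¹ ^ (k + 1)) t := by
  refine ((((hasDerivAt_id t).const_add a).inv h).pow k).congr_deriv ?_
  rcases k with _ | k
  · simp
  · simp only [Nat.add_sub_cancel, Pi.inv_apply, id_eq, div_eq_mul_inv, ← inv_pow]
    ring

theorem hasDerivAt_integral_inv_sq_add_pow (μ : Measure ℝ≥0) [IsFiniteMeasure μ] {t : ℝ}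
    (ht : 0 < t) (k : ℕ) :
    HasDerivAt (fun t : ℝ => ∫ x : ℝ≥0, ((x : ℝ) ^ 2 + t)⁻¹ ^ k ∂μ)
      (∫ x : ℝ≥0, -k * ((x : ℝ) ^ 2 + t)⁻¹ ^ (k + 1) ∂μ) t := by
  have hpos : ∀ {s : ℝ}, s ∈ Set.Ioi (t / 2) → 0 < s := fun hs => (half_pos ht).trans hs
  have hs : Set.Ioi (t / 2) ∈ 𝓝 t := Ioi_mem_nhds (half_lt_self ht)
  refine (hasDerivAt_integral_of_dominated_loc_of_deriv_le (μ := μ)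
    (F' := fun t (x : ℝ≥0) => -k * ((x : ℝ) ^ 2 + t)⁻¹ ^ (k + 1))
    (bound := fun _ => k * (t / 2)⁻¹ ^ (k + 1)) hs ?_ (integrable_inv_sq_add_pow μ ht k)
    ((integrable_inv_sq_add_pow μ ht (k + 1)).const_mul _).1 ?_ (integrable_const _) ?_).2
  · filter_upwards [hs] with s hs using (integrable_inv_sq_add_pow μ (hpos hs) k).1
  · refine Eventually.of_forall fun x s hs => ?_
    have hs₀ := hpos hs
    have hts : t / 2 ≤ (x : ℝ) ^ 2 + s := by nlinarith [sq_nonneg (x : ℝ), Set.mem_Ioi.1 hs]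
    rw [norm_mul, norm_neg, Real.norm_natCast, Real.norm_of_nonneg (by positivity)]
    gcongr
  · refine Eventually.of_forall fun x s hs => hasDerivAt_inv_add_pow ?_ k
    have hs₀ := hpos hs
    positivity

/-- The transform `t ↦ ∫ (x² + t)⁻¹ dμ(x)`. If `μ` is the law of `|X|` for a symmetric random
variable `X` with Stieltjes transform `m(w) = 𝔼 (X - w)⁻¹`, then `m(i v) = i v ∫ (x² + v²)⁻¹ dμ`. -/
noncomputable def invSqTransform (μ : ProbabilityMeasure ℝ≥0) (t : ℝ) : ℝ :=
  ∫ x : ℝ≥0, ((x : ℝ) ^ 2 + t)⁻¹ ∂(μ : Measure ℝ≥0)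

theorem continuous_invSqTransform {t : ℝ} (ht : 0 < t) :
    Continuous fun μ => invSqTransform μ t :=
  ProbabilityMeasure.continuous_integral_boundedContinuousFunction (invSqTest t ht)

variable {μ ν : ProbabilityMeasure ℝ≥0} {t₀ : ℝ}

theorem integral_inv_sq_add_pow_eq_of_invSqTransform_eq (ht₀ : 0 < t₀)
    (h : ∀ t, t₀ < t → invSqTransform μ t = invSqTransform ν t) (k : ℕ) :
    ∀ t, t₀ < t → ∫ x : ℝ≥0, ((x : ℝ) ^ 2 + t)⁻¹ ^ k ∂(μ : Measure ℝ≥0)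
      = ∫ x : ℝ≥0, ((x : ℝ) ^ 2 + t)⁻¹ ^ k ∂(ν : Measure ℝ≥0) := by
  induction k with
  | zero => intro t _; simp
  | succ k ih =>
    intro t ht
    rcases Nat.eq_zero_or_pos k with rfl | hk
    · simp only [zero_add, pow_one]
      exact h t ht
    have hderiv := (hasDerivAt_integral_inv_sq_add_pow μ (ht₀.trans ht) k).unique
      ((hasDerivAt_integral_inv_sq_add_pow ν (ht₀.trans ht) k).congr_of_eventuallyEq
        (by filter_upwards [Ioi_mem_nhds ht] with s hs using ih s hs))
    rw [integral_const_mul, integral_const_mul] at hderiv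
    exact mul_left_cancel₀ (neg_ne_zero.mpr (Nat.cast_ne_zero.mpr hk.ne')) hderiv

theorem integral_aeval_invSqTest (μ : Measure ℝ≥0) [IsFiniteMeasure μ] {t : ℝ} (ht : 0 < t)
    (p : Polynomial ℝ) :
    ∫ x, (Polynomial.aeval (invSqTest t ht) p) x ∂μ = ∑ k ∈ Finset.range (p.natDegree + 1),
      p.coeff k * ∫ x : ℝ≥0, ((x : ℝ) ^ 2 + t)⁻¹ ^ k ∂μ := by
  simp_rw [← integral_const_mul]
  rw [← integral_finsetSum _ fun k _ => (integrable_inv_sq_add_pow μ ht k).const_mul _]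
  simp [Polynomial.aeval_eq_sum_range]

/-- The derivatives in `t` give the integrals of all powers of `(x² + t)⁻¹`, and the algebra
generated by this function separates the points of `[0, ∞)`. -/
theorem eq_of_invSqTransform_eq (ht₀ : 0 < t₀)
    (h : ∀ t, t₀ < t → invSqTransform μ t = invSqTransform ν t) : μ = ν := by
  have ht₁ : t₀ < t₀ + 1 := lt_add_one t₀
  set u := invSqTest (t₀ + 1) (ht₀.trans ht₁)
  let A : StarSubalgebra ℝ (ℝ≥0 →ᵇ ℝ) :=
    { Algebra.adjoin ℝ {u} with
      star_mem' := fun {a} ha => by rwa [show star a = a by ext x; simp] }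
  have mem_A : ∀ g : ℝ≥0 →ᵇ ℝ, g ∈ A ↔ g ∈ Algebra.adjoin ℝ {u} := fun g => Iff.rfl
  refine Subtype.ext (ext_of_forall_mem_subalgebra_integral_eq_of_polish (P := (μ : Measure ℝ≥0))
    (P' := (ν : Measure ℝ≥0)) (𝕜 := ℝ) (A := A) ?_ ?_)
  · intro x y hxy
    exact ⟨u, ⟨BoundedContinuousFunction.toContinuousMapStarₐ ℝ u,
      ⟨u, (mem_A u).2 (Algebra.subset_adjoin rfl), rfl⟩, rfl⟩,
      (invSqTest_injective (ht₀.trans ht₁)).ne hxy⟩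
  · intro g hg
    rw [mem_A, Algebra.adjoin_singleton_eq_range_aeval] at hg
    obtain ⟨p, rfl⟩ := hg
    refine (integral_aeval_invSqTest (μ : Measure ℝ≥0) _ p).trans
      (Eq.trans ?_ (integral_aeval_invSqTest (ν : Measure ℝ≥0) _ p).symm)
    exact Finset.sum_congr rfl fun k _ => by
      rw [integral_inv_sq_add_pow_eq_of_invSqTransform_eq ht₀ h k _ ht₁]

end ResolventTransform

section SecondMoment

/-- Probability measures on `[0, ∞)` with second moment at most `C`. -/
def secondMomentLE (C : ℝ≥0) : Set (ProbabilityMeasure ℝ≥0) :=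
  {μ | ∫⁻ x : ℝ≥0, (x : ℝ≥0∞) ^ 2 ∂(μ : Measure ℝ≥0) ≤ C}

theorem measure_compl_Icc_le_lintegral_sq_div (μ : Measure ℝ≥0) {R : ℝ≥0} (hR : 0 < R) :
    μ (Set.Icc 0 R)ᶜ ≤ (∫⁻ x : ℝ≥0, (x : ℝ≥0∞) ^ 2 ∂μ) / (R : ℝ≥0∞) ^ 2 := by
  have hsub : (Set.Icc 0 R)ᶜ ⊆ {x : ℝ≥0 | (R : ℝ≥0∞) ^ 2 ≤ (x : ℝ≥0∞) ^ 2} := fun x hx => by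
    have hRx : R < x := by simpa using hx
    have : (R : ℝ≥0∞) ≤ x := by exact_mod_cast hRx.le
    exact pow_le_pow_left' this 2
  exact (measure_mono hsub).trans <| meas_ge_le_lintegral_div (by fun_prop)
    (by simpa using hR.ne') (by simp)

theorem isCompact_closure_secondMomentLE (C : ℝ≥0) : IsCompact (closure (secondMomentLE C)) := by
  refine isCompact_closure_of_isTightMeasureSet ?_
  rw [isTightMeasureSet_iff_exists_isCompact_measure_compl_le]
  intro ε hε
  have hlim : Tendsto (fun R : ℝ≥0 => (C : ℝ≥0∞) / (R : ℝ≥0∞) ^ 2) atTop (𝓝 0) := by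
    have htop : Tendsto (fun R : ℝ≥0 => (R : ℝ≥0∞) ^ 2) atTop (𝓝 ∞) := by
      simp_rw [← ENNReal.coe_pow]
      exact ENNReal.tendsto_coe_nhds_top.2 (tendsto_pow_atTop two_ne_zero)
    simpa using ENNReal.Tendsto.const_div htop (Or.inr ENNReal.coe_ne_top)
  obtain ⟨R, hRε, hR⟩ := ((hlim.eventually (gt_mem_nhds hε)).and (eventually_gt_atTop 0)).exists
  refine ⟨Set.Icc 0 R, isCompact_Icc, ?_⟩
  rintro _ ⟨μ, hμ, rfl⟩
  calc (μ : Measure ℝ≥0) (Set.Icc 0 R)ᶜ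
      ≤ (∫⁻ x : ℝ≥0, (x : ℝ≥0∞) ^ 2 ∂(μ : Measure ℝ≥0)) / (R : ℝ≥0∞) ^ 2 :=
        measure_compl_Icc_le_lintegral_sq_div _ hR
    _ ≤ C / (R : ℝ≥0∞) ^ 2 := by gcongr; exact hμ
    _ ≤ ε := hRε.le

end SecondMoment

section ConvergenceInProbability

theorem exists_finset_forall_dist_lt_imp_mem_of_isCompact {X ι M : Type*} [TopologicalSpace X]
    [PseudoMetricSpace M] {φ : X → ι → M} {h : ι → M} {T : Set ι}
    (hφ : ∀ t ∈ T, Continuous fun x => φ x t) {K U : Set X} (hK : IsCompact K) (hU : IsOpen U)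
    (hKU : ∀ x ∈ K, (∀ t ∈ T, dist (φ x t) (h t) = 0) → x ∈ U) :
    ∃ (S : Finset ι) (δ : ℝ), ↑S ⊆ T ∧ 0 < δ ∧
      ∀ x ∈ K, (∀ t ∈ S, dist (φ x t) (h t) < δ) → x ∈ U := by
  classical
  have hopen : ∀ p : T × ℕ, IsOpen {x | (1 : ℝ) / (p.2 + 1) < dist (φ x p.1) (h p.1)} := fun p =>
    isOpen_lt continuous_const ((hφ p.1 p.1.2).dist continuous_const)
  have hcover : K \ U ⊆ ⋃ p : T × ℕ, {x | (1 : ℝ) / (p.2 + 1) < dist (φ x p.1) (h p.1)} := by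
    rintro x ⟨hxK, hxU⟩
    obtain ⟨t, htT, ht⟩ : ∃ t ∈ T, dist (φ x t) (h t) ≠ 0 := by
      by_contra! hcon
      exact hxU (hKU x hxK hcon)
    obtain ⟨m, hm⟩ := exists_nat_one_div_lt (dist_nonneg.lt_of_ne' ht)
    exact Set.mem_iUnion.2 ⟨(⟨t, htT⟩, m), hm⟩
  obtain ⟨s, hs⟩ := (hK.diff hU).elim_finite_subcover _ hopen hcover
  refine ⟨s.image fun p => (p.1 : ι), 1 / ((s.sup Prod.snd : ℕ) + 1), ?_, by positivity, ?_⟩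
  · intro t ht
    obtain ⟨p, -, rfl⟩ := Finset.mem_image.1 (Finset.mem_coe.1 ht)
    exact p.1.2
  · intro x hxK hx
    by_contra hxU
    obtain ⟨p, hps, hp⟩ := Set.mem_iUnion₂.1 (hs ⟨hxK, hxU⟩)
    have hle : (1 : ℝ) / ((s.sup Prod.snd : ℕ) + 1) ≤ 1 / (p.2 + 1) :=
      Nat.one_div_le_one_div (Finset.le_sup hps)
    exact (hp.trans ((hx p.1 (Finset.mem_image_of_mem _ hps)).trans_le hle)).false

variable {Ω : ℕ → Type*} [∀ n, MeasurableSpace (Ω n)] {P : ∀ n, Measure (Ω n)}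
  {μ : ∀ n, Ω n → ProbabilityMeasure ℝ≥0} {t₀ : ℝ} {h : ℝ → ℝ}

theorem tendsto_measure_notMem_of_invSqTransform (ht₀ : 0 < t₀)
    (htight : ∀ η : ℝ≥0∞, 0 < η → ∃ C : ℝ≥0, ∀ n, P n {ω | μ n ω ∉ secondMomentLE C} ≤ η)
    (hconv : ∀ t, t₀ < t → ∀ δ : ℝ, 0 < δ →
      Tendsto (fun n => P n {ω | δ ≤ |invSqTransform (μ n ω) t - h t|}) atTop (𝓝 0))
    {U : Set (ProbabilityMeasure ℝ≥0)} (hU : IsOpen U)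
    (hhU : ∀ ν, (∀ t, t₀ < t → invSqTransform ν t = h t) → ν ∈ U) :
    Tendsto (fun n => P n {ω | μ n ω ∉ U}) atTop (𝓝 0) := by
  rw [ENNReal.tendsto_nhds_zero]
  intro η hη
  obtain ⟨C, hC⟩ := htight (η / 2) (ENNReal.half_pos hη.ne')
  obtain ⟨S, δ, hST, hδ, hS⟩ := exists_finset_forall_dist_lt_imp_mem_of_isCompact
    (φ := invSqTransform) (h := h) (T := Set.Ioi t₀)
    (fun t ht => continuous_invSqTransform (ht₀.trans ht))
    (isCompact_closure_secondMomentLE C) hU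
    (fun ν _ hν => hhU ν fun t ht => dist_eq_zero.1 (hν t ht))
  have hsum : Tendsto (fun n => ∑ t ∈ S, P n {ω | δ ≤ |invSqTransform (μ n ω) t - h t|})
      atTop (𝓝 0) := by
    simpa using tendsto_finsetSum S fun t ht => hconv t (hST ht) δ hδ
  filter_upwards [ENNReal.tendsto_nhds_zero.1 hsum (η / 2) (ENNReal.half_pos hη.ne')] with n hn
  have hsub : {ω | μ n ω ∉ U} ⊆ {ω | μ n ω ∉ secondMomentLE C} ∪
      ⋃ t ∈ S, {ω | δ ≤ |invSqTransform (μ n ω) t - h t|} := by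
    intro ω hω
    by_contra hcon
    simp only [Set.mem_union, Set.mem_iUnion, Set.mem_ofPred_eq, not_or, not_not, not_exists,
      not_le] at hcon
    exact hω (hS _ (subset_closure hcon.1) hcon.2)
  calc P n {ω | μ n ω ∉ U} ≤ _ := measure_mono hsub
    _ ≤ _ := measure_union_le _ _
    _ ≤ η / 2 + η / 2 := add_le_add (hC n) ((measure_biUnion_finset_le S _).trans hn)
    _ = η := ENNReal.add_halves η

theorem exists_invSqTransform_eq [∀ n, IsProbabilityMeasure (P n)] (ht₀ : 0 < t₀)
    (htight : ∀ η : ℝ≥0∞, 0 < η → ∃ C : ℝ≥0, ∀ n, P n {ω | μ n ω ∉ secondMomentLE C} ≤ η)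
    (hconv : ∀ t, t₀ < t → ∀ δ : ℝ, 0 < δ →
      Tendsto (fun n => P n {ω | δ ≤ |invSqTransform (μ n ω) t - h t|}) atTop (𝓝 0)) :
    ∃ ν : ProbabilityMeasure ℝ≥0, ∀ t, t₀ < t → invSqTransform ν t = h t := by
  by_contra! hcon
  have hlim := tendsto_measure_notMem_of_invSqTransform ht₀ htight hconv isOpen_empty
    fun ν hν => by obtain ⟨t, ht, hne⟩ := hcon ν; exact hne (hν t ht)
  simp at hlim

theorem continuous_integral_boundedContinuousFunction_complex (f : ℝ≥0 →ᵇ ℂ) :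
    Continuous fun ν : ProbabilityMeasure ℝ≥0 => ∫ x, f x ∂(ν : Measure ℝ≥0) :=
  continuous_iff_continuousAt.2 fun _ =>
    (ProbabilityMeasure.tendsto_iff_forall_integral_rclike_tendsto ℂ).1 tendsto_id f

theorem tendsto_measure_lt_norm_integral_sub_of_invSqTransform (ht₀ : 0 < t₀)
    (htight : ∀ η : ℝ≥0∞, 0 < η → ∃ C : ℝ≥0, ∀ n, P n {ω | μ n ω ∉ secondMomentLE C} ≤ η)
    (hconv : ∀ t, t₀ < t → ∀ δ : ℝ, 0 < δ →
      Tendsto (fun n => P n {ω | δ ≤ |invSqTransform (μ n ω) t - h t|}) atTop (𝓝 0))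
    {ν : ProbabilityMeasure ℝ≥0} (hν : ∀ t, t₀ < t → invSqTransform ν t = h t)
    (f : ℝ≥0 →ᵇ ℂ) {ε : ℝ} (hε : 0 < ε) :
    Tendsto (fun n => P n {ω | ε < ‖∫ x, f x ∂(μ n ω : Measure ℝ≥0) - ∫ x, f x ∂(ν : Measure ℝ≥0)‖})
      atTop (𝓝 0) := by
  set U : Set (ProbabilityMeasure ℝ≥0) :=
    {κ | ‖∫ x, f x ∂(κ : Measure ℝ≥0) - ∫ x, f x ∂(ν : Measure ℝ≥0)‖ < ε}
  have hU : IsOpen U := isOpen_lt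
    ((continuous_integral_boundedContinuousFunction_complex f).sub continuous_const).norm
    continuous_const
  have hlim := tendsto_measure_notMem_of_invSqTransform ht₀ htight hconv hU fun κ hκ => by
    rw [eq_of_invSqTransform_eq ht₀ fun t ht => (hκ t ht).trans (hν t ht).symm]
    simpa [U] using hε
  refine tendsto_of_tendsto_of_tendsto_of_le_of_le tendsto_const_nhds hlim (fun _ => zero_le)
    fun n => measure_mono fun ω hω => ?_
  simpa [U] using hω.le

end ConvergenceInProbability

section ImagResolvent

variable {ι : Type*} [Fintype ι] [DecidableEq ι] {H H₀ : Matrix ι ι ℂ} {v : ℝ}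

/-- The resolvent `(H - i v)⁻¹` at the point `i v` of the imaginary axis. -/
noncomputable def imagResolvent (H : Matrix ι ι ℂ) (v : ℝ) : Matrix ι ι ℂ :=
  (H - (Complex.I * v) • (1 : Matrix ι ι ℂ))⁻¹

theorem isUnit_det_sub_imag (hH : H.IsHermitian) (hv : v ≠ 0) :
    IsUnit (H - (Complex.I * v) • (1 : Matrix ι ι ℂ)).det := by
  have hspec : Complex.I * v ∉ spectrum ℂ H := by
    rw [hH.spectrum_eq_image_range]
    rintro ⟨x, -, hx⟩
    exact hv (by simpa using (congrArg Complex.im hx).symm)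
  rw [spectrum.notMem_iff, ← IsUnit.neg_iff, neg_sub, Algebra.algebraMap_eq_smul_one] at hspec
  exact (Matrix.isUnit_iff_isUnit_det _).1 hspec

theorem sub_imag_mul_imagResolvent (hH : H.IsHermitian) (hv : v ≠ 0) :
    (H - (Complex.I * v) • (1 : Matrix ι ι ℂ)) * imagResolvent H v = 1 :=
  Matrix.mul_nonsing_inv _ (isUnit_det_sub_imag hH hv)

theorem imagResolvent_mul_sub_imag (hH : H.IsHermitian) (hv : v ≠ 0) :
    imagResolvent H v * (H - (Complex.I * v) • (1 : Matrix ι ι ℂ)) = 1 :=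
  Matrix.nonsing_inv_mul _ (isUnit_det_sub_imag hH hv)

theorem imagResolvent_eq_sub (hH : H.IsHermitian) (hH₀ : H₀.IsHermitian) (hv : v ≠ 0) :
    imagResolvent H v =
      imagResolvent H₀ v - imagResolvent H₀ v * (H - H₀) * imagResolvent H v := by
  rw [← sub_sub_sub_cancel_right H H₀ ((Complex.I * v) • (1 : Matrix ι ι ℂ)), mul_sub, sub_mul,
    imagResolvent_mul_sub_imag hH₀ hv, one_mul, mul_assoc, sub_imag_mul_imagResolvent hH hv,
    mul_one]
  abel

theorem conjTranspose_imagResolvent (hH : H.IsHermitian) (v : ℝ) :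
    (imagResolvent H v).conjTranspose = imagResolvent H (-v) := by
  simp [imagResolvent, Matrix.conjTranspose_nonsing_inv, hH.eq]

theorem imagResolvent_sub_conjTranspose (hH : H.IsHermitian) (hv : v ≠ 0) :
    imagResolvent H v - (imagResolvent H v).conjTranspose =
      (2 * Complex.I * v) • (imagResolvent H v * (imagResolvent H v).conjTranspose) := by
  rw [conjTranspose_imagResolvent hH]
  calc imagResolvent H v - imagResolvent H (-v)
      = imagResolvent H v * ((H - (Complex.I * ((-v : ℝ) : ℂ)) • (1 : Matrix ι ι ℂ))
          - (H - (Complex.I * v) • (1 : Matrix ι ι ℂ))) * imagResolvent H (-v) := by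
        rw [mul_sub, sub_mul, imagResolvent_mul_sub_imag hH hv, mul_assoc,
          sub_imag_mul_imagResolvent hH (neg_ne_zero.2 hv), mul_one, one_mul]
    _ = imagResolvent H v * ((2 * Complex.I * v) • (1 : Matrix ι ι ℂ)) * imagResolvent H (-v) := by
        rw [sub_sub_sub_cancel_left, ← sub_smul]
        congr 3
        push_cast
        ring
    _ = (2 * Complex.I * v) • (imagResolvent H v * imagResolvent H (-v)) := by simp

theorem im_imagResolvent_apply_self (hH : H.IsHermitian) (hv : v ≠ 0) (p : ι) :
    (imagResolvent H v p p).im = v * ∑ q, ‖imagResolvent H v p q‖ ^ 2 := by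
  have hward := congrArg Complex.im
    (congrFun (congrFun (imagResolvent_sub_conjTranspose hH hv) p) p)
  set R := imagResolvent H v
  have hdiag : (R * R.conjTranspose) p p = ((∑ q, ‖R p q‖ ^ 2 : ℝ) : ℂ) := by
    simp [Matrix.mul_apply, Complex.mul_conj']
  rw [Matrix.smul_apply, hdiag, Matrix.sub_apply, Matrix.conjTranspose_apply, smul_eq_mul,
    Complex.im_mul_ofReal, Complex.sub_im, Complex.star_def, Complex.conj_im] at hward
  have hcoeff : (2 * Complex.I * v).im = 2 * v := by simp
  rw [hcoeff] at hward
  linarith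

theorem sum_norm_sq_row_imagResolvent_le (hH : H.IsHermitian) (hv : v ≠ 0) (p : ι) :
    ∑ q, ‖imagResolvent H v p q‖ ^ 2 ≤ (v ^ 2)⁻¹ := by
  have hward := im_imagResolvent_apply_self hH hv p
  set R := imagResolvent H v
  set S := ∑ q, ‖R p q‖ ^ 2
  have hS : 0 ≤ S := Finset.sum_nonneg fun q _ => by positivity
  have hdiag : ‖R p p‖ ^ 2 ≤ S :=
    Finset.single_le_sum (f := fun q => ‖R p q‖ ^ 2) (fun q _ => by positivity) (Finset.mem_univ p)
  have him : (v * S) ^ 2 ≤ S := by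
    rw [← hward]
    exact (sq_le_sq.2 ((Complex.abs_im_le_norm _).trans (le_abs_self _))).trans hdiag
  rcases hS.eq_or_lt with hS | hS
  · rw [← hS]
    positivity
  · rw [← one_div, le_div_iff₀ (by positivity)]
    refine le_of_mul_le_mul_left ?_ hS
    linarith

theorem sum_norm_sq_col_imagResolvent_le (hH : H.IsHermitian) (hv : v ≠ 0) (q : ι) :
    ∑ p, ‖imagResolvent H v p q‖ ^ 2 ≤ (v ^ 2)⁻¹ := by
  have h := sum_norm_sq_row_imagResolvent_le hH (neg_ne_zero.2 hv) q
  rw [← conjTranspose_imagResolvent hH] at h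
  simpa using h

theorem norm_imagResolvent_apply_le (hH : H.IsHermitian) (hv : v ≠ 0) (p q : ι) :
    ‖imagResolvent H v p q‖ ≤ |v|⁻¹ := by
  refine le_of_sq_le_sq ?_ (by positivity)
  rw [inv_pow, sq_abs]
  exact (Finset.single_le_sum (f := fun q => ‖imagResolvent H v p q‖ ^ 2)
    (fun q _ => by positivity) (Finset.mem_univ q)).trans
    (sum_norm_sq_row_imagResolvent_le hH hv p)

end ImagResolvent

section Hermitization

variable {ι : Type*}

/-- The Hermitian block matrix with off-diagonal blocks `W` and `Wᴴ`. -/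
def hermitization (W : Matrix ι ι ℂ) : Matrix (Bool × ι) (Bool × ι) ℂ :=
  Matrix.of fun p q => if q.1 = p.1 then 0 else if p.1 then conj (W q.2 p.2) else W p.2 q.2

theorem isHermitian_hermitization (W : Matrix ι ι ℂ) : (hermitization W).IsHermitian := by
  ext ⟨a, i⟩ ⟨b, j⟩
  cases a <;> cases b <;> simp [hermitization, Matrix.conjTranspose_apply]

theorem hermitization_add (V W : Matrix ι ι ℂ) :
    hermitization (V + W) = hermitization V + hermitization W := by
  ext ⟨a, i⟩ ⟨b, j⟩
  cases a <;> cases b <;> simp [hermitization]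

theorem hermitization_sub (V W : Matrix ι ι ℂ) :
    hermitization (V - W) = hermitization V - hermitization W := by
  rw [eq_sub_iff_add_eq, ← hermitization_add, sub_add_cancel]

variable [DecidableEq ι]

theorem hermitization_ite_single_ofReal (a : Bool) (i j : ι) (c : ℝ) :
    hermitization (if a then Matrix.single j i (c : ℂ) else Matrix.single i j (c : ℂ)) =
      Matrix.single (a, i) (!a, j) (c : ℂ) + Matrix.single (!a, j) (a, i) (c : ℂ) := by
  ext ⟨b, k⟩ ⟨d, l⟩
  cases a <;> cases b <;> cases d <;>
    simp [hermitization, Matrix.single_apply, apply_ite conj, and_comm]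

/-- `A` with its entries at `(i, j)` and `(j, i)` replaced by zero. -/
def erasePair (i j : ι) (A : Matrix ι ι ℝ) : Matrix ι ι ℝ :=
  Matrix.of fun k l => if s(k, l) = s(i, j) then 0 else A k l

theorem erasePair_comm (i j : ι) (A : Matrix ι ι ℝ) : erasePair i j A = erasePair j i A := by
  simp only [erasePair, Sym2.eq_swap]

theorem sub_erasePair (A : Matrix ι ι ℝ) {i j : ι} (hij : i ≠ j) :
    A - erasePair i j A = Matrix.single i j (A i j) + Matrix.single j i (A j i) := by
  ext k l
  simp only [erasePair, Matrix.sub_apply, Matrix.of_apply, Matrix.add_apply, Matrix.single_apply,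
    Sym2.eq_iff]
  grind

/-- `A` for `a = false` and its transpose for `a = true`. -/
def orient (a : Bool) (A : Matrix ι ι ℝ) (i j : ι) : ℝ := if a then A j i else A i j

/-- `z` for `a = false` and its conjugate for `a = true`. -/
def orientShift (a : Bool) (z : ℂ) : ℂ := if a then conj z else z

theorem norm_orientShift (a : Bool) (z : ℂ) : ‖orientShift a z‖ = ‖z‖ := by
  cases a <;> simp [orientShift]

theorem sub_erasePair_eq_orient (a : Bool) (A : Matrix ι ι ℝ) {i j : ι} (hij : i ≠ j) :
    A - erasePair i j A =
      (if a then Matrix.single j i (orient a A i j) else Matrix.single i j (orient a A i j)) +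
      (if a then Matrix.single i j (orient a A j i) else Matrix.single j i (orient a A j i)) := by
  rw [sub_erasePair A hij]
  cases a <;> simp [orient, add_comm]

end Hermitization

section HermResolvent

variable {n : ℕ}

/-- The scaling factor `n^{-1/2}`. -/
noncomputable def invSqrt (n : ℕ) : ℝ := (Real.sqrt n)⁻¹

theorem invSqrt_nonneg (n : ℕ) : 0 ≤ invSqrt n := inv_nonneg.2 (Real.sqrt_nonneg _)

theorem invSqrt_le_one (n : ℕ) : invSqrt n ≤ 1 := by
  rcases Nat.eq_zero_or_pos n with rfl | hn
  · simp [invSqrt]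
  · exact inv_le_one_of_one_le₀ (Real.one_le_sqrt.2 (by exact_mod_cast hn))

theorem invSqrt_sq (n : ℕ) : invSqrt n ^ 2 = (n : ℝ)⁻¹ := by
  rw [invSqrt, inv_pow, Real.sq_sqrt (Nat.cast_nonneg n)]

/-- The Hermitization of `n^{-1/2} A - z`. -/
noncomputable def shiftedHerm (z : ℂ) (A : Matrix (Fin n) (Fin n) ℝ) :
    Matrix (Bool × Fin n) (Bool × Fin n) ℂ := hermitization (shiftedMatrix A z)

theorem shiftedHerm_apply_self_block (z : ℂ) (A : Matrix (Fin n) (Fin n) ℝ) (a : Bool)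
    (i j : Fin n) : shiftedHerm z A (a, i) (a, j) = 0 := by
  simp [shiftedHerm, hermitization]

theorem shiftedHerm_apply_not_block (z : ℂ) (A : Matrix (Fin n) (Fin n) ℝ) (a : Bool)
    (i j : Fin n) : shiftedHerm z A (a, i) (!a, j) =
      (invSqrt n : ℂ) * orient a A i j - if i = j then orientShift a z else 0 := by
  simp only [shiftedHerm, hermitization, shiftedMatrix, orient, orientShift, invSqrt]
  cases a <;> rcases eq_or_ne i j with rfl | hij <;> simp_all [Matrix.one_apply, Ne.symm]

theorem isHermitian_shiftedHerm (z : ℂ) (A : Matrix (Fin n) (Fin n) ℝ) :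
    (shiftedHerm z A).IsHermitian := isHermitian_hermitization _

theorem shiftedHerm_sub_erasePair (z : ℂ) (A : Matrix (Fin n) (Fin n) ℝ) (a : Bool)
    {i j : Fin n} (hij : i ≠ j) :
    shiftedHerm z A - shiftedHerm z (erasePair i j A) =
      Matrix.single (a, i) (!a, j) ((invSqrt n * orient a A i j : ℝ) : ℂ) +
      Matrix.single (!a, j) (a, i) ((invSqrt n * orient a A i j : ℝ) : ℂ) +
      (Matrix.single (a, j) (!a, i) ((invSqrt n * orient a A j i : ℝ) : ℂ) +
      Matrix.single (!a, i) (a, j) ((invSqrt n * orient a A j i : ℝ) : ℂ)) := by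
  have hshift : shiftedMatrix A z - shiftedMatrix (erasePair i j A) z =
      (invSqrt n • (A - erasePair i j A)).map Complex.ofReal := by
    ext k l
    simp [shiftedMatrix, invSqrt, mul_sub]
  rw [shiftedHerm, shiftedHerm, ← hermitization_sub, hshift, sub_erasePair_eq_orient a A hij,
    ← hermitization_ite_single_ofReal, ← hermitization_ite_single_ofReal, ← hermitization_add]
  congr 1
  have hmap (k l : Fin n) (x : ℝ) :
      (Matrix.single k l x).map Complex.ofReal = Matrix.single k l (x : ℂ) :=
    Matrix.map_single k l x Complex.ofRealHom
  cases a <;> simp [Matrix.map_add, smul_add, Matrix.smul_single, hmap]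

/-- The resolvent at `i v` of the Hermitization of `n^{-1/2} A - z`. -/
noncomputable def hermResolvent (z : ℂ) (v : ℝ) (A : Matrix (Fin n) (Fin n) ℝ) :
    Matrix (Bool × Fin n) (Bool × Fin n) ℂ := imagResolvent (shiftedHerm z A) v

/-- The matrix `R (E + Eᴴ) S`, where `E` is the matrix unit at `((a, i), (!a, j))`: the resolvent
perturbation caused by one entry of the underlying matrix. -/
def pairTerm (a : Bool) (i j : Fin n) (R S : Matrix (Bool × Fin n) (Bool × Fin n) ℂ)
    (p q : Bool × Fin n) : ℂ :=
  R p (a, i) * S (!a, j) q + R p (!a, j) * S (a, i) q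

theorem mul_single_mul_apply {κ : Type*} [Fintype κ] [DecidableEq κ] (A B : Matrix κ κ ℂ)
    (u w p q : κ) (c : ℂ) : (A * Matrix.single u w c * B) p q = c * (A p u * B w q) := by
  rw [Matrix.mul_apply, Finset.sum_eq_single w]
  · rw [Matrix.mul_single_apply_same]
    ring
  · intro k _ hk
    rw [Matrix.mul_single_apply_of_ne _ _ _ _ _ hk, zero_mul]
  · simp

variable {z : ℂ} {v : ℝ}

theorem hermResolvent_eq_erasePair (hv : v ≠ 0) (A : Matrix (Fin n) (Fin n) ℝ) (a : Bool)
    {i j : Fin n} (hij : i ≠ j) (p q : Bool × Fin n) :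
    hermResolvent z v A p q = hermResolvent z v (erasePair i j A) p q -
      invSqrt n * (orient a A i j * pairTerm a i j (hermResolvent z v (erasePair i j A))
          (hermResolvent z v A) p q +
        orient a A j i * pairTerm a j i (hermResolvent z v (erasePair i j A))
          (hermResolvent z v A) p q) := by
  have h := congrFun (congrFun (imagResolvent_eq_sub (isHermitian_shiftedHerm z A)
    (isHermitian_shiftedHerm z (erasePair i j A)) hv) p) q
  rw [shiftedHerm_sub_erasePair z A a hij] at h
  simp only [mul_add, add_mul, Matrix.sub_apply, Matrix.add_apply, mul_single_mul_apply] at h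
  unfold hermResolvent pairTerm
  refine h.trans ?_
  push_cast
  ring

theorem invSqrt_mul_sum_orient_mul_hermResolvent (hv : v ≠ 0) (A : Matrix (Fin n) (Fin n) ℝ)
    (a b : Bool) (i : Fin n) :
    invSqrt n * ∑ j, orient a A i j * hermResolvent z v A (!a, j) (b, i) =
      (if a = b then 1 else 0) + orientShift a z * hermResolvent z v A (!a, i) (b, i)
        + Complex.I * v * hermResolvent z v A (a, i) (b, i) := by
  have hinv := congrFun (congrFun (sub_imag_mul_imagResolvent (isHermitian_shiftedHerm z A) hv)
    (a, i)) (b, i)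
  have hbool : ∀ f : Bool → ℂ, ∑ c, f c = f a + f (!a) := fun f => by cases a <;> simp [add_comm]
  rw [sub_mul, Matrix.sub_apply, smul_mul_assoc, one_mul, Matrix.smul_apply, Matrix.mul_apply,
    Fintype.sum_prod_type, hbool] at hinv
  simp only [shiftedHerm_apply_self_block, shiftedHerm_apply_not_block, zero_mul,
    Finset.sum_const_zero, zero_add, sub_mul, Finset.sum_sub_distrib, ite_mul, Finset.sum_ite_eq,
    Finset.mem_univ, if_true, Matrix.one_apply, Prod.mk.injEq, and_true, smul_eq_mul] at hinv
  rw [Finset.mul_sum]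
  simp only [← mul_assoc]
  unfold hermResolvent
  linear_combination hinv

theorem norm_hermResolvent_apply_le_one (hv : 1 ≤ v) (A : Matrix (Fin n) (Fin n) ℝ)
    (p q : Bool × Fin n) : ‖hermResolvent z v A p q‖ ≤ 1 :=
  (norm_imagResolvent_apply_le (isHermitian_shiftedHerm z A) (zero_lt_one.trans_le hv).ne' p
    q).trans (inv_le_one_of_one_le₀ (hv.trans (le_abs_self v)))

theorem sum_prodMk_le_sum {κ τ : Type*} [Fintype κ] [Fintype τ] {f : κ × τ → ℝ}
    (hf : ∀ p, 0 ≤ f p) (a : κ) : ∑ k, f (a, k) ≤ ∑ p, f p := by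
  rw [Fintype.sum_prod_type]
  exact Finset.single_le_sum (f := fun a => ∑ k, f (a, k))
    (fun a _ => Finset.sum_nonneg fun k _ => hf _) (Finset.mem_univ a)

theorem sum_norm_sq_row_hermResolvent_le_one (hv : 1 ≤ v) (A : Matrix (Fin n) (Fin n) ℝ)
    (p : Bool × Fin n) (b : Bool) : ∑ k, ‖hermResolvent z v A p (b, k)‖ ^ 2 ≤ 1 :=
  (sum_prodMk_le_sum (f := fun q => ‖hermResolvent z v A p q‖ ^ 2) (fun _ => by positivity) b).trans
    ((sum_norm_sq_row_imagResolvent_le (isHermitian_shiftedHerm z A) (zero_lt_one.trans_le hv).ne'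
      p).trans (inv_le_one_of_one_le₀ (one_le_pow₀ hv)))

theorem sum_norm_sq_col_hermResolvent_le_one (hv : 1 ≤ v) (A : Matrix (Fin n) (Fin n) ℝ)
    (q : Bool × Fin n) (a : Bool) : ∑ k, ‖hermResolvent z v A (a, k) q‖ ^ 2 ≤ 1 :=
  (sum_prodMk_le_sum (f := fun p => ‖hermResolvent z v A p q‖ ^ 2) (fun _ => by positivity) a).trans
    ((sum_norm_sq_col_imagResolvent_le (isHermitian_shiftedHerm z A) (zero_lt_one.trans_le hv).ne'
      q).trans (inv_le_one_of_one_le₀ (one_le_pow₀ hv)))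

end HermResolvent

section DysonEquation

theorem norm_mul_sub_mul_le {R : Type*} [NonUnitalSeminormedRing R] {a b c d : R} {α β ε η : ℝ}
    (hb : ‖b‖ ≤ β) (hc : ‖c‖ ≤ α) (hac : ‖a - c‖ ≤ ε) (hbd : ‖b - d‖ ≤ η) :
    ‖a * b - c * d‖ ≤ ε * β + α * η := by
  have hsplit : a * b - c * d = (a - c) * b + c * (b - d) := by noncomm_ring
  rw [hsplit]
  exact norm_add_le_of_le (norm_mul_le_of_le hac hb) (norm_mul_le_of_le hc hbd)

theorem norm_apply_apply_le {ι κ E : Type*} [Fintype ι] [Fintype κ] [SeminormedAddCommGroup E]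
    (g : ι → κ → E) (a : ι) (b : κ) : ‖g a b‖ ≤ ‖g‖ :=
  (norm_le_pi_norm (g a) b).trans (norm_le_pi_norm g a)

theorem norm_le_of_forall_apply_apply_le {ι κ E : Type*} [Fintype ι] [Fintype κ]
    [SeminormedAddCommGroup E] {g : ι → κ → E} {r : ℝ} (hr : 0 ≤ r) (h : ∀ a b, ‖g a b‖ ≤ r) :
    ‖g‖ ≤ r :=
  (pi_norm_le_iff_of_nonneg hr).2 fun a => (pi_norm_le_iff_of_nonneg hr).2 fun b => h a b

variable {ρ : ℝ} {z : ℂ} {v : ℝ} {g g' : Bool → Bool → ℂ}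

/-- The part of the Dyson equation that does not depend on the spectral parameter. -/
noncomputable def dysonDrift (ρ : ℝ) (z : ℂ) (g : Bool → Bool → ℂ) : Bool → Bool → ℂ :=
  fun a b => (if a = b then 1 else 0) + orientShift a z * g (!a) b + g (!a) (!a) * g a b +
    ρ * (g (!a) a * g (!a) b)

/-- The amount by which `g` fails to solve the Dyson equation at the spectral parameter `i v`; the
equation is satisfied by the normalized block traces of the resolvent of the Hermitization in the
limit of large dimension. -/
noncomputable def dysonDefect (ρ : ℝ) (z : ℂ) (v : ℝ) (g : Bool → Bool → ℂ) : Bool → Bool → ℂ :=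
  dysonDrift ρ z g + (Complex.I * v) • g

theorem norm_dysonDrift_le (hρ : |ρ| ≤ 1) (z : ℂ) (hg : ‖g‖ ≤ 1) :
    ‖dysonDrift ρ z g‖ ≤ ‖z‖ + 4 := by
  refine norm_le_of_forall_apply_apply_le (by positivity) fun a b => ?_
  have hone (c d : Bool) : ‖g c d‖ ≤ 1 := (norm_apply_apply_le g c d).trans hg
  have hdelta : ‖(if a = b then (1 : ℂ) else 0)‖ ≤ 1 := by split_ifs <;> simp
  have hshift : ‖orientShift a z * g (!a) b‖ ≤ ‖z‖ * 1 :=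
    norm_mul_le_of_le (norm_orientShift a z).le (hone _ _)
  have hdiag : ‖g (!a) (!a) * g a b‖ ≤ 1 * 1 := norm_mul_le_of_le (hone _ _) (hone _ _)
  have hcorr : ‖(ρ : ℂ) * (g (!a) a * g (!a) b)‖ ≤ 1 * (1 * 1) :=
    norm_mul_le_of_le (by simpa using hρ) (norm_mul_le_of_le (hone _ _) (hone _ _))
  exact (norm_add₄_le).trans (by linarith)

theorem norm_dysonDrift_sub_le (hρ : |ρ| ≤ 1) (z : ℂ) (hg : ‖g‖ ≤ 1) (hg' : ‖g'‖ ≤ 1) :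
    ‖dysonDrift ρ z g - dysonDrift ρ z g'‖ ≤ (‖z‖ + 4) * ‖g - g'‖ := by
  refine norm_le_of_forall_apply_apply_le (by positivity) fun a b => ?_
  have hone (c d : Bool) : ‖g c d‖ ≤ 1 := (norm_apply_apply_le g c d).trans hg
  have hone' (c d : Bool) : ‖g' c d‖ ≤ 1 := (norm_apply_apply_le g' c d).trans hg'
  have hsub (c d : Bool) : ‖g c d - g' c d‖ ≤ ‖g - g'‖ := norm_apply_apply_le (g - g') c d
  have hprod (c d c' d' : Bool) :
      ‖g c d * g c' d' - g' c d * g' c' d'‖ ≤ ‖g - g'‖ * 1 + 1 * ‖g - g'‖ :=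
    norm_mul_sub_mul_le (hone _ _) (hone' _ _) (hsub _ _) (hsub _ _)
  have hshift : ‖orientShift a z * (g (!a) b - g' (!a) b)‖ ≤ ‖z‖ * ‖g - g'‖ :=
    norm_mul_le_of_le (norm_orientShift a z).le (hsub _ _)
  have hcorr : ‖(ρ : ℂ) * (g (!a) a * g (!a) b - g' (!a) a * g' (!a) b)‖ ≤
      1 * (‖g - g'‖ * 1 + 1 * ‖g - g'‖) :=
    norm_mul_le_of_le (by simpa using hρ) (hprod _ _ _ _)
  have hsplit : (dysonDrift ρ z g - dysonDrift ρ z g') a b =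
      orientShift a z * (g (!a) b - g' (!a) b) + (g (!a) (!a) * g a b - g' (!a) (!a) * g' a b)
        + ρ * (g (!a) a * g (!a) b - g' (!a) a * g' (!a) b) := by
    simp only [Pi.sub_apply, dysonDrift]
    ring
  rw [hsplit]
  exact (norm_add₃_le).trans (by linarith [hprod (!a) (!a) a b])

theorem norm_I_mul_smul {E : Type*} [SeminormedAddCommGroup E] [NormedSpace ℂ E] (hv : 0 ≤ v)
    (g : E) :
    ‖(Complex.I * (v : ℂ)) • g‖ = v * ‖g‖ := by
  rw [norm_smul, norm_mul, Complex.norm_I, one_mul, Complex.norm_real, Real.norm_of_nonneg hv]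

theorem norm_dysonDefect_le (hρ : |ρ| ≤ 1) (z : ℂ) (hv : 0 ≤ v) (hg : ‖g‖ ≤ 1) :
    ‖dysonDefect ρ z v g‖ ≤ ‖z‖ + 4 + v := by
  refine norm_add_le_of_le (norm_dysonDrift_le hρ z hg) ?_
  rw [norm_I_mul_smul hv]
  exact mul_le_of_le_one_right hv hg

theorem norm_dysonDefect_sub_le (hρ : |ρ| ≤ 1) (z : ℂ) (hv : 0 ≤ v) (hg : ‖g‖ ≤ 1)
    (hg' : ‖g'‖ ≤ 1) :
    ‖dysonDefect ρ z v g - dysonDefect ρ z v g'‖ ≤ (‖z‖ + 4 + v) * ‖g - g'‖ := by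
  rw [dysonDefect, dysonDefect, add_sub_add_comm, ← smul_sub, add_mul, ← norm_I_mul_smul hv]
  exact norm_add_le_of_le (norm_dysonDrift_sub_le hρ z hg hg') le_rfl

/-- `g` solves the Dyson equation at `i v` and has entries of modulus at most `1`; the bound singles
out one of the several solutions of this quadratic equation. -/
structure IsDysonSolution (ρ : ℝ) (z : ℂ) (v : ℝ) (g : Bool → Bool → ℂ) : Prop where
  norm_le_one : ‖g‖ ≤ 1
  defect_eq_zero : dysonDefect ρ z v g = 0

theorem isDysonSolution_iff_isFixedPt (hv : v ≠ 0) :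
    IsDysonSolution ρ z v g ↔
      ‖g‖ ≤ 1 ∧ Function.IsFixedPt (fun g => -((Complex.I * v)⁻¹ • dysonDrift ρ z g)) g := by
  have hIv : Complex.I * (v : ℂ) ≠ 0 := by simp [hv]
  have hfix : dysonDefect ρ z v g = 0 ↔
      Function.IsFixedPt (fun g => -((Complex.I * v)⁻¹ • dysonDrift ρ z g)) g := by
    rw [Function.IsFixedPt, neg_eq_iff_eq_neg, inv_smul_eq_iff₀ hIv, smul_neg,
      ← add_eq_zero_iff_eq_neg, dysonDefect]
  exact ⟨fun h => ⟨h.norm_le_one, hfix.1 h.defect_eq_zero⟩, fun h => ⟨h.1, hfix.2 h.2⟩⟩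

theorem exists_isDysonSolution (hρ : |ρ| ≤ 1) (z : ℂ) (hv : 2 * (‖z‖ + 4) ≤ v) :
    ∃ g, IsDysonSolution ρ z v g := by
  have hv0 : 0 < v := by linarith [norm_nonneg z]
  have hinv : ‖(Complex.I * (v : ℂ))⁻¹‖ = v⁻¹ := by simp [abs_of_pos hv0]
  have hhalf : v⁻¹ * (‖z‖ + 4) ≤ 1 / 2 := by
    rw [inv_mul_le_iff₀ hv0]
    linarith
  have hmaps : Set.MapsTo (fun g => -((Complex.I * v)⁻¹ • dysonDrift ρ z g))
      (Metric.closedBall 0 1) (Metric.closedBall 0 1) := by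
    intro g hg
    rw [mem_closedBall_zero_iff] at hg ⊢
    rw [norm_neg, norm_smul, hinv]
    exact (mul_le_mul_of_nonneg_left (norm_dysonDrift_le hρ z hg) (by positivity)).trans
      (hhalf.trans (by norm_num))
  have hcontr : ContractingWith (1 / 2) (hmaps.restrict _ _ _) := by
    refine ⟨by norm_num, LipschitzWith.of_dist_le_mul ?_⟩
    rintro ⟨g, hg⟩ ⟨g', hg'⟩
    rw [mem_closedBall_zero_iff] at hg hg'
    simp only [Subtype.dist_eq, Set.MapsTo.val_restrict_apply, dist_eq_norm]
    rw [neg_sub_neg, ← smul_sub, norm_smul, hinv, ← norm_sub_rev]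
    calc v⁻¹ * ‖dysonDrift ρ z g - dysonDrift ρ z g'‖
        ≤ v⁻¹ * ((‖z‖ + 4) * ‖g - g'‖) := by
          gcongr
          exact norm_dysonDrift_sub_le hρ z hg hg'
      _ = v⁻¹ * (‖z‖ + 4) * ‖g - g'‖ := by ring
      _ ≤ 1 / 2 * ‖g - g'‖ := by gcongr
      _ = ((1 / 2 : ℝ≥0) : ℝ) * ‖g - g'‖ := by norm_num
  obtain ⟨g, hg, hfix, -⟩ := hcontr.exists_fixedPoint' Metric.isClosed_closedBall.isComplete hmaps
    (x := 0) (by simp) (edist_ne_top _ _)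
  exact ⟨g, (isDysonSolution_iff_isFixedPt hv0.ne').2 ⟨mem_closedBall_zero_iff.1 hg, hfix⟩⟩

theorem IsDysonSolution.norm_sub_le_norm_dysonDefect (hg' : IsDysonSolution ρ z v g')
    (hρ : |ρ| ≤ 1) (hv : 2 * (‖z‖ + 4) ≤ v) (hg : ‖g‖ ≤ 1) :
    ‖g - g'‖ ≤ ‖dysonDefect ρ z v g‖ := by
  have hz := norm_nonneg z
  have hdist := norm_nonneg (g - g')
  have hsplit : (Complex.I * (v : ℂ)) • (g - g') =
      dysonDefect ρ z v g - (dysonDrift ρ z g - dysonDrift ρ z g') := by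
    have h := hg'.defect_eq_zero
    rw [dysonDefect, add_eq_zero_iff_eq_neg'] at h
    rw [smul_sub, h, dysonDefect]
    abel
  have hlin : v * ‖g - g'‖ ≤ ‖dysonDefect ρ z v g‖ + (‖z‖ + 4) * ‖g - g'‖ := by
    rw [← norm_I_mul_smul (by linarith), hsplit]
    exact norm_sub_le_of_le le_rfl (norm_dysonDrift_sub_le hρ z hg hg'.norm_le_one)
  nlinarith

/-- The solution of the Dyson equation at `i v`. It is unique for `|ρ| ≤ 1` and
`2 * (‖z‖ + 4) ≤ v`, and a junk value if there is none. -/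
noncomputable def dysonSolution (ρ : ℝ) (z : ℂ) (v : ℝ) : Bool → Bool → ℂ :=
  Classical.epsilon (IsDysonSolution ρ z v)

theorem isDysonSolution_dysonSolution (hρ : |ρ| ≤ 1) (z : ℂ) (hv : 2 * (‖z‖ + 4) ≤ v) :
    IsDysonSolution ρ z v (dysonSolution ρ z v) :=
  Classical.epsilon_spec (exists_isDysonSolution hρ z hv)

end DysonEquation

section BlockTrace

variable {n : ℕ} {z : ℂ} {v : ℝ}

/-- The normalized traces of the four blocks of the resolvent of the Hermitization. -/
noncomputable def blockTrace (z : ℂ) (v : ℝ) (A : Matrix (Fin n) (Fin n) ℝ) : Bool → Bool → ℂ :=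
  fun a b => (n : ℂ)⁻¹ * ∑ k, hermResolvent z v A (a, k) (b, k)

theorem norm_blockTrace_le_one (hv : 1 ≤ v) (A : Matrix (Fin n) (Fin n) ℝ) :
    ‖blockTrace z v A‖ ≤ 1 := by
  refine norm_le_of_forall_apply_apply_le zero_le_one fun a b => ?_
  rw [blockTrace, norm_mul, norm_inv, Complex.norm_natCast]
  refine inv_mul_le_one_of_le₀ ?_ (Nat.cast_nonneg n)
  simpa using norm_sum_le_of_le Finset.univ fun k _ =>
    norm_hermResolvent_apply_le_one (z := z) hv A (a, k) (b, k)

theorem dysonDefect_blockTrace (hn : n ≠ 0) (hv : v ≠ 0) (ρ : ℝ) (A : Matrix (Fin n) (Fin n) ℝ)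
    (a b : Bool) : dysonDefect ρ z v (blockTrace z v A) a b =
      (n : ℂ)⁻¹ * (invSqrt n * ∑ i, ∑ j, orient a A i j * hermResolvent z v A (!a, j) (b, i)) +
        blockTrace z v A (!a) (!a) * blockTrace z v A a b +
        ρ * (blockTrace z v A (!a) a * blockTrace z v A (!a) b) := by
  have hn' : (n : ℂ) ≠ 0 := Nat.cast_ne_zero.2 hn
  have hrows : invSqrt n * ∑ i, ∑ j, orient a A i j * hermResolvent z v A (!a, j) (b, i) =
      n * (if a = b then 1 else 0) + orientShift a z * ∑ i, hermResolvent z v A (!a, i) (b, i)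
        + Complex.I * v * ∑ i, hermResolvent z v A (a, i) (b, i) := by
    rw [Finset.mul_sum]
    simp only [invSqrt_mul_sum_orient_mul_hermResolvent hv, Finset.sum_add_distrib,
      Finset.mul_sum, Finset.sum_const, Finset.card_univ, Fintype.card_fin, nsmul_eq_mul]
  rw [hrows]
  simp only [dysonDefect, dysonDrift, Pi.add_apply, Pi.smul_apply, smul_eq_mul, blockTrace]
  field_simp
  ring

end BlockTrace

section PairPerturbation

variable {n : ℕ} {z : ℂ} {v : ℝ}

theorem norm_pairTerm_le {i j : Fin n} {R S : Matrix (Bool × Fin n) (Bool × Fin n) ℂ}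
    (hR : ∀ p q, ‖R p q‖ ≤ 1) (hS : ∀ p q, ‖S p q‖ ≤ 1) (a : Bool) (p q : Bool × Fin n) :
    ‖pairTerm a i j R S p q‖ ≤ 2 :=
  (norm_add_le_of_le (norm_mul_le_of_le (hR _ _) (hS _ _))
    (norm_mul_le_of_le (hR _ _) (hS _ _))).trans (by norm_num)

theorem norm_pairTerm_sub_le {i j : Fin n} {R S R' S' : Matrix (Bool × Fin n) (Bool × Fin n) ℂ}
    (hR' : ∀ p q, ‖R' p q‖ ≤ 1) (hS : ∀ p q, ‖S p q‖ ≤ 1) {ε η : ℝ}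
    (hRR' : ∀ p q, ‖R p q - R' p q‖ ≤ ε) (hSS' : ∀ p q, ‖S p q - S' p q‖ ≤ η)
    (a : Bool) (p q : Bool × Fin n) :
    ‖pairTerm a i j R S p q - pairTerm a i j R' S' p q‖ ≤ 2 * (ε + η) := by
  rw [pairTerm, pairTerm, add_sub_add_comm]
  exact (norm_add_le_of_le (norm_mul_sub_mul_le (hS _ _) (hR' _ _) (hRR' _ _) (hSS' _ _))
    (norm_mul_sub_mul_le (hS _ _) (hR' _ _) (hRR' _ _) (hSS' _ _))).trans_eq (by ring)

/-- The size of the pair of entries at `(i, j)` and `(j, i)`. -/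
def pairSize (A : Matrix (Fin n) (Fin n) ℝ) (i j : Fin n) : ℝ := |A i j| + |A j i|

theorem pairSize_nonneg (A : Matrix (Fin n) (Fin n) ℝ) (i j : Fin n) : 0 ≤ pairSize A i j :=
  add_nonneg (abs_nonneg _) (abs_nonneg _)

theorem abs_orient_add_abs_orient (a : Bool) (A : Matrix (Fin n) (Fin n) ℝ) (i j : Fin n) :
    |orient a A i j| + |orient a A j i| = pairSize A i j := by
  cases a <;> simp [orient, pairSize, add_comm]

theorem abs_orient_le_pairSize (a : Bool) (A : Matrix (Fin n) (Fin n) ℝ) (i j : Fin n) :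
    |orient a A i j| ≤ pairSize A i j := by
  rw [← abs_orient_add_abs_orient a]
  exact le_add_of_nonneg_right (abs_nonneg _)

theorem norm_orient_combination_le (a : Bool) (A : Matrix (Fin n) (Fin n) ℝ) (i j : Fin n)
    {w w' : ℂ} {c : ℝ} (hw : ‖w‖ ≤ c) (hw' : ‖w'‖ ≤ c) :
    ‖invSqrt n * (orient a A i j * w + orient a A j i * w')‖ ≤
      invSqrt n * (c * pairSize A i j) := by
  have hcomb : ‖orient a A i j * w + orient a A j i * w'‖ ≤
      |orient a A i j| * c + |orient a A j i| * c :=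
    norm_add_le_of_le (norm_mul_le_of_le (Complex.norm_real _).le hw)
      (norm_mul_le_of_le (Complex.norm_real _).le hw')
  rw [← add_mul, abs_orient_add_abs_orient, mul_comm _ c] at hcomb
  rw [norm_mul, Complex.norm_real, Real.norm_of_nonneg (invSqrt_nonneg n)]
  exact mul_le_mul_of_nonneg_left hcomb (invSqrt_nonneg n)

theorem norm_hermResolvent_sub_erasePair_le (hv : 1 ≤ v) (A : Matrix (Fin n) (Fin n) ℝ)
    {i j : Fin n} (hij : i ≠ j) (p q : Bool × Fin n) :
    ‖hermResolvent z v A p q - hermResolvent z v (erasePair i j A) p q‖ ≤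
      2 * (invSqrt n * pairSize A i j) := by
  rw [hermResolvent_eq_erasePair (zero_lt_one.trans_le hv).ne' A false hij, sub_sub_cancel_left,
    norm_neg, mul_left_comm]
  exact norm_orient_combination_le false A i j
    (norm_pairTerm_le (norm_hermResolvent_apply_le_one hv _)
      (norm_hermResolvent_apply_le_one hv _) ..)
    (norm_pairTerm_le (norm_hermResolvent_apply_le_one hv _)
      (norm_hermResolvent_apply_le_one hv _) ..)

theorem norm_sum_mul_le_one {ι : Type*} (s : Finset ι) {f g : ι → ℂ}
    (hf : ∑ k ∈ s, ‖f k‖ ^ 2 ≤ 1) (hg : ∑ k ∈ s, ‖g k‖ ^ 2 ≤ 1) : ‖∑ k ∈ s, f k * g k‖ ≤ 1 := by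
  have hcs := Real.sum_mul_le_sqrt_mul_sqrt s (fun k => ‖f k‖) fun k => ‖g k‖
  refine (norm_sum_le _ _).trans ?_
  simp only [norm_mul]
  exact hcs.trans (mul_le_one₀ (Real.sqrt_le_one.2 hf) (Real.sqrt_nonneg _)
    (Real.sqrt_le_one.2 hg))

theorem norm_sum_pairTerm_le (hv : 1 ≤ v) (A A' : Matrix (Fin n) (Fin n) ℝ) (c a b : Bool)
    (i j : Fin n) : ‖∑ k, pairTerm c i j (hermResolvent z v A) (hermResolvent z v A')
      (a, k) (b, k)‖ ≤ 2 := by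
  have hprod (p q : Bool × Fin n) :
      ‖∑ k, hermResolvent z v A (a, k) p * hermResolvent z v A' q (b, k)‖ ≤ 1 :=
    norm_sum_mul_le_one _ (sum_norm_sq_col_hermResolvent_le_one hv A p a)
      (sum_norm_sq_row_hermResolvent_le_one hv A' q b)
  simp only [pairTerm, Finset.sum_add_distrib]
  exact (norm_add_le_of_le (hprod _ _) (hprod _ _)).trans (by norm_num)

theorem norm_blockTrace_sub_erasePair_le (hv : 1 ≤ v) (A : Matrix (Fin n) (Fin n) ℝ)
    {i j : Fin n} (hij : i ≠ j) :
    ‖blockTrace z v A - blockTrace z v (erasePair i j A)‖ ≤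
      2 * (invSqrt n ^ 3 * pairSize A i j) := by
  have hs := invSqrt_nonneg n
  have hr := pairSize_nonneg A i j
  refine norm_le_of_forall_apply_apply_le (by positivity) fun a b => ?_
  have hexpand : (blockTrace z v A - blockTrace z v (erasePair i j A)) a b =
      -((n : ℂ)⁻¹ * (invSqrt n * (orient false A i j *
        ∑ k, pairTerm false i j (hermResolvent z v (erasePair i j A)) (hermResolvent z v A)
          (a, k) (b, k) +
        orient false A j i *
        ∑ k, pairTerm false j i (hermResolvent z v (erasePair i j A)) (hermResolvent z v A)
          (a, k) (b, k)))) := by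
    simp only [Pi.sub_apply, blockTrace]
    rw [← mul_sub, ← Finset.sum_sub_distrib, ← mul_neg]
    congr 1
    rw [Finset.mul_sum, Finset.mul_sum, ← Finset.sum_add_distrib, Finset.mul_sum,
      ← Finset.sum_neg_distrib]
    refine Finset.sum_congr rfl fun k _ => ?_
    rw [hermResolvent_eq_erasePair (zero_lt_one.trans_le hv).ne' A false hij]
    ring
  rw [hexpand, norm_neg, norm_mul, norm_inv, Complex.norm_natCast, ← invSqrt_sq]
  calc _ ≤ invSqrt n ^ 2 * (invSqrt n * (2 * pairSize A i j)) := by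
        gcongr
        exact norm_orient_combination_le false A i j (norm_sum_pairTerm_le hv _ A false a b i j)
          (norm_sum_pairTerm_le hv _ A false a b j i)
    _ = 2 * (invSqrt n ^ 3 * pairSize A i j) := by ring

end PairPerturbation

section CumulantExpansion

variable {n : ℕ} {z : ℂ} {v ρ : ℝ}

/-- The contribution of the covariance structure of the pair of entries at `(i, j)` and `(j, i)`
to the second order expansion of the resolvent `R` in that pair. -/
def covarianceTerm (ρ : ℝ) (a : Bool) (i j : Fin n) (R : Matrix (Bool × Fin n) (Bool × Fin n) ℂ)
    (p q : Bool × Fin n) : ℂ :=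
  pairTerm a i j R R p q + ρ * pairTerm a j i R R p q

/-- The part of the double sum of covariance terms that does not factor into block traces. -/
def pairRemainder (ρ : ℝ) (a b : Bool) (R : Matrix (Bool × Fin n) (Bool × Fin n) ℂ) : ℂ :=
  ∑ i, ∑ j, R (!a, j) (a, i) * R (!a, j) (b, i) +
    ρ * ∑ i, ∑ j, R (!a, j) (!a, i) * R (a, j) (b, i)

/-- An entry of the underlying matrix times an entry of the resolvent, compensated by the second
order term of its expansion so that the sum has almost zero mean. -/
noncomputable def cumulantTerm (ρ : ℝ) (z : ℂ) (v : ℝ) (a : Bool) (i j : Fin n)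
    (p q : Bool × Fin n) (A : Matrix (Fin n) (Fin n) ℝ) : ℂ :=
  orient a A i j * hermResolvent z v A p q +
    invSqrt n * covarianceTerm ρ a i j (hermResolvent z v A) p q

/-- The approximation of `cumulantTerm` in which the resolvent is evaluated at a matrix `B` not
involving the pair of entries `x`, `y` at `(i, j)` and `(j, i)`. -/
noncomputable def decoupledTerm (ρ : ℝ) (z : ℂ) (v : ℝ) (a : Bool) (i j : Fin n)
    (p q : Bool × Fin n) (x y : ℝ) (B : Matrix (Fin n) (Fin n) ℝ) : ℂ :=
  x * (hermResolvent z v B p q - invSqrt n *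
      (x * pairTerm a i j (hermResolvent z v B) (hermResolvent z v B) p q +
        y * pairTerm a j i (hermResolvent z v B) (hermResolvent z v B) p q)) +
    invSqrt n * covarianceTerm ρ a i j (hermResolvent z v B) p q

theorem norm_ofReal_mul_le_of_abs_le_one (hρ : |ρ| ≤ 1) {w : ℂ} {c : ℝ} (hw : ‖w‖ ≤ c) :
    ‖(ρ : ℂ) * w‖ ≤ c :=
  (norm_mul_le_of_le ((Complex.norm_real ρ).trans_le hρ) hw).trans_eq (one_mul c)

theorem sum_covarianceTerm (ρ : ℝ) (a b : Bool) (R : Matrix (Bool × Fin n) (Bool × Fin n) ℂ) :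
    ∑ i, ∑ j, covarianceTerm ρ a i j R (!a, j) (b, i) =
      (∑ k, R (!a, k) (!a, k)) * (∑ k, R (a, k) (b, k)) +
      ρ * ((∑ k, R (!a, k) (a, k)) * ∑ k, R (!a, k) (b, k)) + pairRemainder ρ a b R := by
  have hprod (c d e f : Bool) : (∑ k, R (c, k) (d, k)) * (∑ k, R (e, k) (f, k)) =
      ∑ i, ∑ j, R (c, j) (d, j) * R (e, i) (f, i) := by
    rw [Finset.sum_mul_sum, Finset.sum_comm]
  rw [hprod, hprod, pairRemainder]
  simp only [covarianceTerm, pairTerm, Finset.sum_add_distrib, mul_add, Finset.mul_sum]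
  ring

theorem norm_pairRemainder_le (hρ : |ρ| ≤ 1) (hv : 1 ≤ v) (a b : Bool)
    (A : Matrix (Fin n) (Fin n) ℝ) : ‖pairRemainder ρ a b (hermResolvent z v A)‖ ≤ 2 * n := by
  have hprod (c d e f : Bool) : ‖∑ i, ∑ j, hermResolvent z v A (c, j) (d, i) *
      hermResolvent z v A (e, j) (f, i)‖ ≤ n := by
    simpa using norm_sum_le_of_le Finset.univ fun i _ => norm_sum_mul_le_one Finset.univ
      (sum_norm_sq_col_hermResolvent_le_one (z := z) hv A (d, i) c)
      (sum_norm_sq_col_hermResolvent_le_one (z := z) hv A (f, i) e)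
  rw [two_mul]
  exact norm_add_le_of_le (hprod ..) (norm_ofReal_mul_le_of_abs_le_one hρ (hprod ..))

theorem dysonDefect_blockTrace_eq_sum_cumulantTerm (hn : n ≠ 0) (hv : v ≠ 0) (ρ : ℝ)
    (A : Matrix (Fin n) (Fin n) ℝ) (a b : Bool) :
    dysonDefect ρ z v (blockTrace z v A) a b =
      (invSqrt n : ℂ) ^ 3 * ∑ i, ∑ j, cumulantTerm ρ z v a i j (!a, j) (b, i) A -
      (invSqrt n : ℂ) ^ 4 * pairRemainder ρ a b (hermResolvent z v A) := by
  have hs : (n : ℂ)⁻¹ = (invSqrt n : ℂ) ^ 2 := by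
    rw [← Complex.ofReal_pow, invSqrt_sq]
    push_cast
    rfl
  simp only [dysonDefect_blockTrace hn hv, cumulantTerm, Finset.sum_add_distrib, ← Finset.mul_sum,
    sum_covarianceTerm, blockTrace, hs]
  ring

theorem norm_covarianceTerm_le (hρ : |ρ| ≤ 1) {R : Matrix (Bool × Fin n) (Bool × Fin n) ℂ}
    (hR : ∀ p q, ‖R p q‖ ≤ 1) (a : Bool) (i j : Fin n) (p q : Bool × Fin n) :
    ‖covarianceTerm ρ a i j R p q‖ ≤ 4 :=
  (norm_add_le_of_le (norm_pairTerm_le hR hR a p q)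
    (norm_ofReal_mul_le_of_abs_le_one hρ (norm_pairTerm_le hR hR a p q))).trans (by norm_num)

theorem norm_covarianceTerm_sub_le (hρ : |ρ| ≤ 1)
    {R R' : Matrix (Bool × Fin n) (Bool × Fin n) ℂ} (hR : ∀ p q, ‖R p q‖ ≤ 1)
    (hR' : ∀ p q, ‖R' p q‖ ≤ 1) {ε : ℝ} (hRR' : ∀ p q, ‖R p q - R' p q‖ ≤ ε)
    (a : Bool) (i j : Fin n) (p q : Bool × Fin n) :
    ‖covarianceTerm ρ a i j R p q - covarianceTerm ρ a i j R' p q‖ ≤ 8 * ε := by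
  rw [covarianceTerm, covarianceTerm, add_sub_add_comm, ← mul_sub]
  exact (norm_add_le_of_le (norm_pairTerm_sub_le hR' hR hRR' hRR' a p q)
    (norm_ofReal_mul_le_of_abs_le_one hρ (norm_pairTerm_sub_le hR' hR hRR' hRR' a p q))).trans_eq
      (by ring)

theorem norm_cumulantTerm_le (hρ : |ρ| ≤ 1) (hv : 1 ≤ v) (a : Bool) (i j : Fin n)
    (p q : Bool × Fin n) (A : Matrix (Fin n) (Fin n) ℝ) :
    ‖cumulantTerm ρ z v a i j p q A‖ ≤ |orient a A i j| + 4 := by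
  have hR := norm_hermResolvent_apply_le_one (z := z) hv A
  have hs : ‖(invSqrt n : ℂ)‖ ≤ 1 := by
    rw [Complex.norm_real, Real.norm_of_nonneg (invSqrt_nonneg n)]
    exact invSqrt_le_one n
  exact (norm_add_le_of_le (norm_mul_le_of_le (Complex.norm_real _).le (hR p q))
    (norm_mul_le_of_le hs (norm_covarianceTerm_le hρ hR a i j p q))).trans_eq (by simp)

theorem norm_secondOrder_sub_hermResolvent_le (hv : 1 ≤ v) (A : Matrix (Fin n) (Fin n) ℝ)
    (a : Bool) {i j : Fin n} (hij : i ≠ j) (p q : Bool × Fin n) :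
    ‖hermResolvent z v (erasePair i j A) p q - invSqrt n *
        (orient a A i j * pairTerm a i j (hermResolvent z v (erasePair i j A))
            (hermResolvent z v (erasePair i j A)) p q +
          orient a A j i * pairTerm a j i (hermResolvent z v (erasePair i j A))
            (hermResolvent z v (erasePair i j A)) p q) - hermResolvent z v A p q‖ ≤
      4 * (invSqrt n * pairSize A i j) ^ 2 := by
  have hterm (k l : Fin n) :
      ‖pairTerm a k l (hermResolvent z v (erasePair i j A)) (hermResolvent z v A) p q -
        pairTerm a k l (hermResolvent z v (erasePair i j A))
          (hermResolvent z v (erasePair i j A)) p q‖ ≤ 4 * (invSqrt n * pairSize A i j) :=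
    (norm_pairTerm_sub_le (norm_hermResolvent_apply_le_one hv _)
      (norm_hermResolvent_apply_le_one hv _) (fun p q => (by simp : _ ≤ (0 : ℝ)))
      (norm_hermResolvent_sub_erasePair_le hv A hij) a p q).trans_eq (by ring)
  rw [hermResolvent_eq_erasePair (zero_lt_one.trans_le hv).ne' A a hij, sub_sub_sub_cancel_left,
    ← mul_sub, add_sub_add_comm, ← mul_sub, ← mul_sub]
  exact (norm_orient_combination_le a A i j (hterm i j) (hterm j i)).trans_eq (by ring)

theorem decoupling_error_le {s r L : ℝ} (hs : 0 ≤ s) (hs₁ : s ≤ 1) (hr : 0 ≤ r) (hL : 0 ≤ L) :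
    r * (4 * (s * r) ^ 2 * L + 1 * (L * (2 * (s ^ 3 * r)))) +
        s * (8 * (2 * (s * r)) * L + 4 * (L * (2 * (s ^ 3 * r)))) ≤
      30 * L * s ^ 2 * (1 + r ^ 3) := by
  have hs₃ : s ^ 3 ≤ s ^ 2 := pow_le_pow_of_le_one hs hs₁ (by norm_num)
  have hs₄ : s ^ 3 ≤ s := pow_le_of_le_one hs hs₁ (by norm_num)
  have hr₁ : r ≤ 1 + r ^ 3 := by nlinarith [sq_nonneg (r - 1)]
  have hr₂ : r ^ 2 ≤ 1 + r ^ 3 := by nlinarith [sq_nonneg (r - 1)]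
  calc _ ≤ r * (4 * (s * r) ^ 2 * L + 1 * (L * (2 * (s ^ 2 * r)))) +
        s * (8 * (2 * (s * r)) * L + 4 * (L * (2 * (s * r)))) := by gcongr
    _ = L * s ^ 2 * (4 * r ^ 3 + 2 * r ^ 2 + 24 * r) := by ring
    _ ≤ L * s ^ 2 * (30 * (1 + r ^ 3)) := by gcongr; linarith
    _ = 30 * L * s ^ 2 * (1 + r ^ 3) := by ring

theorem norm_cumulantTerm_mul_sub_decoupledTerm_mul_le (hρ : |ρ| ≤ 1) (hv : 1 ≤ v)
    (A : Matrix (Fin n) (Fin n) ℝ) (a : Bool) {i j : Fin n} (hij : i ≠ j) (p q : Bool × Fin n)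
    {d e : ℂ} {L : ℝ} (hd : ‖d‖ ≤ L) (he : ‖e‖ ≤ L)
    (hde : ‖d - e‖ ≤ L * (2 * (invSqrt n ^ 3 * pairSize A i j))) :
    ‖cumulantTerm ρ z v a i j p q A * d -
        decoupledTerm ρ z v a i j p q (orient a A i j) (orient a A j i) (erasePair i j A) * e‖ ≤
      30 * L * invSqrt n ^ 2 * (1 + pairSize A i j ^ 3) := by
  have hsecond := norm_secondOrder_sub_hermResolvent_le (z := z) hv A a hij p q
  have hcov := norm_covarianceTerm_sub_le hρ (norm_hermResolvent_apply_le_one hv A)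
    (norm_hermResolvent_apply_le_one hv _) (norm_hermResolvent_sub_erasePair_le (z := z) hv A hij)
    a i j p q
  have hx := abs_orient_le_pairSize a A i j
  have hr := pairSize_nonneg A i j
  have hs := invSqrt_nonneg n
  have hs₁ := invSqrt_le_one n
  have hL := (norm_nonneg d).trans hd
  unfold cumulantTerm decoupledTerm
  set s := invSqrt n
  set r := pairSize A i j
  set Q := hermResolvent z v (erasePair i j A) p q - s * _
  rw [add_mul, add_mul, add_sub_add_comm, mul_assoc, mul_assoc, mul_assoc, mul_assoc, ← mul_sub,
    ← mul_sub]
  have hfirst : ‖hermResolvent z v A p q * d - Q * e‖ ≤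
      4 * (s * r) ^ 2 * L + 1 * (L * (2 * (s ^ 3 * r))) := by
    rw [norm_sub_rev]
    exact norm_mul_sub_mul_le he (norm_hermResolvent_apply_le_one hv A p q) hsecond
      ((norm_sub_rev e d).trans_le hde)
  have hcovariance := norm_mul_sub_mul_le hd
    (norm_covarianceTerm_le hρ (norm_hermResolvent_apply_le_one (z := z) hv (erasePair i j A))
      a i j p q) hcov hde
  have hsum := norm_add_le_of_le (norm_mul_le_of_le ((Complex.norm_real _).trans_le hx) hfirst)
    (norm_mul_le_of_le ((Complex.norm_real _).trans_le (abs_of_nonneg hs).le) hcovariance)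
  exact hsum.trans (decoupling_error_le hs hs₁ hr hL)

end CumulantExpansion

section MatrixMeasurability

instance measurableSpaceMatrix {m n α : Type*} [MeasurableSpace α] :
    MeasurableSpace (Matrix m n α) :=
  MeasurableSpace.pi

variable {β m n α : Type*} [MeasurableSpace β] [MeasurableSpace α]

theorem measurable_matrix_apply (i : m) (j : n) : Measurable fun A : Matrix m n α => A i j :=
  (measurable_pi_apply j).comp (measurable_pi_apply (X := fun _ : m => n → α) i)

theorem measurable_matrix_of_apply {f : β → Matrix m n α}
    (hf : ∀ i j, Measurable fun x => f x i j) : Measurable f :=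
  measurable_pi_lambda _ fun i => measurable_pi_lambda _ fun j => hf i j

theorem measurable_matrix_det {ι R : Type*} [Fintype ι] [DecidableEq ι] [CommRing R]
    [MeasurableSpace R] [MeasurableAdd₂ R] [MeasurableMul₂ R] :
    Measurable fun A : Matrix ι ι R => A.det := by
  simp only [Matrix.det_apply']
  exact Finset.measurable_sum _ fun σ _ =>
    (Finset.measurable_prod _ fun i _ => measurable_matrix_apply _ _).const_mul _

theorem measurable_matrix_inv {ι 𝕜 : Type*} [Fintype ι] [DecidableEq ι] [Field 𝕜]
    [MeasurableSpace 𝕜] [MeasurableAdd₂ 𝕜] [MeasurableMul₂ 𝕜] [MeasurableInv 𝕜] :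
    Measurable fun A : Matrix ι ι 𝕜 => A⁻¹ := by
  refine measurable_matrix_of_apply fun i j => ?_
  simp only [Matrix.inv_def, Matrix.smul_apply, smul_eq_mul, Ring.inverse_eq_inv',
    Matrix.adjugate_apply]
  refine measurable_matrix_det.inv.mul (measurable_matrix_det.comp ?_)
  refine measurable_matrix_of_apply fun k l => ?_
  simp only [Matrix.updateRow_apply]
  split_ifs
  · exact measurable_const
  · exact measurable_matrix_apply k l

end MatrixMeasurability

section ResolventMeasurability

variable {n : ℕ}

theorem measurable_erasePair (i j : Fin n) :
    Measurable (erasePair i j : Matrix (Fin n) (Fin n) ℝ → _) := by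
  refine measurable_matrix_of_apply fun k l => ?_
  simp only [erasePair, Matrix.of_apply]
  split_ifs
  · exact measurable_const
  · exact measurable_matrix_apply k l

theorem measurable_orient (a : Bool) (i j : Fin n) :
    Measurable fun A : Matrix (Fin n) (Fin n) ℝ => orient a A i j := by
  cases a <;> exact measurable_matrix_apply _ _

theorem measurable_shiftedHerm (z : ℂ) :
    Measurable (shiftedHerm z : Matrix (Fin n) (Fin n) ℝ → _) := by
  refine measurable_matrix_of_apply ?_
  rintro ⟨a, i⟩ ⟨b, j⟩
  rcases Bool.eq_or_eq_not b a with rfl | rfl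
  · simp only [shiftedHerm_apply_self_block, measurable_const]
  · simp only [shiftedHerm_apply_not_block]
    exact ((Complex.measurable_ofReal.comp (measurable_orient a i j)).const_mul _).sub_const _

theorem measurable_hermResolvent (z : ℂ) (v : ℝ) (p q : Bool × Fin n) :
    Measurable fun A : Matrix (Fin n) (Fin n) ℝ => hermResolvent z v A p q := by
  refine (measurable_matrix_apply p q).comp (measurable_matrix_inv.comp ?_)
  exact measurable_matrix_of_apply fun k l =>
    ((measurable_matrix_apply k l).comp (measurable_shiftedHerm z)).sub_const _

theorem measurable_pairTerm (z : ℂ) (v : ℝ) (a : Bool) (i j : Fin n) (p q : Bool × Fin n) :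
    Measurable fun A : Matrix (Fin n) (Fin n) ℝ =>
      pairTerm a i j (hermResolvent z v A) (hermResolvent z v A) p q :=
  ((measurable_hermResolvent z v _ _).mul (measurable_hermResolvent z v _ _)).add
    ((measurable_hermResolvent z v _ _).mul (measurable_hermResolvent z v _ _))

theorem measurable_cumulantTerm (ρ : ℝ) (z : ℂ) (v : ℝ) (a : Bool) (i j : Fin n)
    (p q : Bool × Fin n) : Measurable (cumulantTerm ρ z v a i j p q) :=
  ((Complex.measurable_ofReal.comp (measurable_orient a i j)).mul
    (measurable_hermResolvent z v p q)).add
    (((measurable_pairTerm z v a i j p q).add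
      ((measurable_pairTerm z v a j i p q).const_mul _)).const_mul _)

theorem measurable_pairRemainder (ρ : ℝ) (z : ℂ) (v : ℝ) (a b : Bool) :
    Measurable fun A : Matrix (Fin n) (Fin n) ℝ => pairRemainder ρ a b (hermResolvent z v A) := by
  have hprod (c d e f : Bool) : Measurable fun A : Matrix (Fin n) (Fin n) ℝ =>
      ∑ i, ∑ j, hermResolvent z v A (c, j) (d, i) * hermResolvent z v A (e, j) (f, i) :=
    Finset.measurable_sum _ fun i _ => Finset.measurable_sum _ fun j _ =>
      (measurable_hermResolvent z v _ _).mul (measurable_hermResolvent z v _ _)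
  exact (hprod ..).add ((hprod ..).const_mul _)

theorem measurable_dysonDefect_blockTrace (ρ : ℝ) (z : ℂ) (v : ℝ) (a b : Bool) :
    Measurable fun A : Matrix (Fin n) (Fin n) ℝ => dysonDefect ρ z v (blockTrace z v A) a b := by
  have htrace (a b : Bool) :
      Measurable fun A : Matrix (Fin n) (Fin n) ℝ => blockTrace z v A a b :=
    (Finset.measurable_sum _ fun _ _ => measurable_hermResolvent z v _ _).const_mul _
  exact ((((htrace _ _).const_mul _).const_add _).add ((htrace _ _).mul (htrace _ _))).add
    (((htrace _ _).mul (htrace _ _)).const_mul _) |>.add ((htrace _ _).const_mul _)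

end ResolventMeasurability

section EllipticMatrix

variable {Ω : Type*} [MeasurableSpace Ω] {P : Measure Ω}

theorem integral_smul_secondOrder_eq_zero [IsFiniteMeasure P] {E : Type*} [NormedAddCommGroup E]
    [NormedSpace ℝ E] [MeasurableSpace E] [BorelSpace E] {x y : Ω → ℝ} {ρ : ℝ} {ψ₀ ψ₁ ψ₂ : Ω → E}
    (hx : MemLp x 2 P) (hy : MemLp y 2 P) (hψ₀ : Integrable ψ₀ P) (hψ₁ : Integrable ψ₁ P)
    (hψ₂ : Integrable ψ₂ P) (hind₀ : IndepFun x ψ₀ P) (hind₁ : IndepFun (fun ω => x ω ^ 2) ψ₁ P)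
    (hind₂ : IndepFun (fun ω => x ω * y ω) ψ₂ P) (hmean : ∫ ω, x ω ∂P = 0)
    (hvar : ∫ ω, x ω ^ 2 ∂P = 1) (hcorr : ∫ ω, x ω * y ω ∂P = ρ) (s : ℝ) :
    Integrable (fun ω => x ω • (ψ₀ ω - s • (x ω • ψ₁ ω + y ω • ψ₂ ω)) +
        s • (ψ₁ ω + ρ • ψ₂ ω)) P ∧
      ∫ ω, (x ω • (ψ₀ ω - s • (x ω • ψ₁ ω + y ω • ψ₂ ω)) + s • (ψ₁ ω + ρ • ψ₂ ω)) ∂P = 0 := by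
  have hx₁ : Integrable x P := hx.integrable one_le_two
  have hxy : Integrable (fun ω => x ω * y ω) P := hx.integrable_mul hy
  have hint₀ : Integrable (fun ω => x ω • ψ₀ ω) P := hind₀.integrable_smul hx₁ hψ₀
  have hint₁ : Integrable (fun ω => (x ω ^ 2) • ψ₁ ω) P :=
    hind₁.integrable_smul hx.integrable_sq hψ₁
  have hint₂ : Integrable (fun ω => (x ω * y ω) • ψ₂ ω) P := hind₂.integrable_smul hxy hψ₂
  have hquad : Integrable (fun ω => s • ((x ω ^ 2) • ψ₁ ω + (x ω * y ω) • ψ₂ ω)) P :=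
    (hint₁.add hint₂).smul s
  have hρψ₂ : Integrable (fun ω => ρ • ψ₂ ω) P := hψ₂.smul ρ
  have hcov : Integrable (fun ω => s • (ψ₁ ω + ρ • ψ₂ ω)) P := (hψ₁.add hρψ₂).smul s
  have hexpand (ω : Ω) : x ω • (ψ₀ ω - s • (x ω • ψ₁ ω + y ω • ψ₂ ω)) =
      x ω • ψ₀ ω - s • ((x ω ^ 2) • ψ₁ ω + (x ω * y ω) • ψ₂ ω) := by module
  have hlin : Integrable (fun ω => x ω • (ψ₀ ω - s • (x ω • ψ₁ ω + y ω • ψ₂ ω))) P := by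
    simp only [hexpand]
    exact hint₀.sub hquad
  refine ⟨hlin.add hcov, ?_⟩
  rw [integral_add hlin hcov, integral_smul, integral_add hψ₁ hρψ₂, integral_smul]
  simp only [hexpand]
  rw [integral_sub hint₀ hquad, integral_smul, integral_add hint₁ hint₂,
    hind₀.integral_fun_smul_eq_smul_integral hx₁.1 hψ₀.1,
    hind₁.integral_fun_smul_eq_smul_integral hx.integrable_sq.1 hψ₁.1,
    hind₂.integral_fun_smul_eq_smul_integral hxy.1 hψ₂.1, hmean, hvar, hcorr]
  module

/-- A random matrix whose off-diagonal entries are centered with unit variance, with correlation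
`ρ` inside each transposed pair, each such pair being independent of all other entries.  The third
absolute moments off the diagonal and the second moments on it are bounded by `M₃` and `κ`. -/
structure IsEllipticMatrix (P : Measure Ω) (ρ : ℝ) (M₃ κ : ℝ≥0) {n : ℕ}
    (A : Ω → Matrix (Fin n) (Fin n) ℝ) : Prop where
  measurable : Measurable A
  indepFun_erasePair : ∀ i j, i ≠ j →
    IndepFun (fun ω => (A ω i j, A ω j i)) (fun ω => erasePair i j (A ω)) P
  memLp_offDiag : ∀ i j, i ≠ j → MemLp (fun ω => A ω i j) 3 P
  mean_offDiag : ∀ i j, i ≠ j → ∫ ω, A ω i j ∂P = 0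
  variance_offDiag : ∀ i j, i ≠ j → ∫ ω, A ω i j ^ 2 ∂P = 1
  correlation : ∀ i j, i ≠ j → ∫ ω, A ω i j * A ω j i ∂P = ρ
  third_moment_offDiag_le : ∀ i j, i ≠ j → ∫ ω, |A ω i j| ^ 3 ∂P ≤ M₃
  memLp_diag : ∀ i, MemLp (fun ω => A ω i i) 2 P
  second_moment_diag_le : ∀ i, ∫ ω, A ω i i ^ 2 ∂P ≤ κ

end EllipticMatrix

namespace IsEllipticMatrix

variable {Ω : Type*} [MeasurableSpace Ω] {P : Measure Ω} {n : ℕ}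
  {A : Ω → Matrix (Fin n) (Fin n) ℝ} {ρ : ℝ} {M₃ κ : ℝ≥0} {z : ℂ} {v : ℝ}

theorem indepFun_orient_erasePair (hA : IsEllipticMatrix P ρ M₃ κ A) (a : Bool) {i j : Fin n}
    (hij : i ≠ j) :
    IndepFun (fun ω => (orient a (A ω) i j, orient a (A ω) j i))
      (fun ω => erasePair i j (A ω)) P := by
  cases a
  · exact hA.indepFun_erasePair i j hij
  · simp only [erasePair_comm i j]
    exact hA.indepFun_erasePair j i hij.symm

theorem memLp_orient (hA : IsEllipticMatrix P ρ M₃ κ A) (a : Bool) {i j : Fin n} (hij : i ≠ j) :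
    MemLp (fun ω => orient a (A ω) i j) 3 P := by
  cases a
  exacts [hA.memLp_offDiag i j hij, hA.memLp_offDiag j i hij.symm]

theorem integral_orient (hA : IsEllipticMatrix P ρ M₃ κ A) (a : Bool) {i j : Fin n}
    (hij : i ≠ j) : ∫ ω, orient a (A ω) i j ∂P = 0 := by
  cases a
  exacts [hA.mean_offDiag i j hij, hA.mean_offDiag j i hij.symm]

theorem integral_orient_sq (hA : IsEllipticMatrix P ρ M₃ κ A) (a : Bool) {i j : Fin n}
    (hij : i ≠ j) : ∫ ω, orient a (A ω) i j ^ 2 ∂P = 1 := by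
  cases a
  exacts [hA.variance_offDiag i j hij, hA.variance_offDiag j i hij.symm]

theorem integral_orient_mul_orient (hA : IsEllipticMatrix P ρ M₃ κ A) (a : Bool) {i j : Fin n}
    (hij : i ≠ j) : ∫ ω, orient a (A ω) i j * orient a (A ω) j i ∂P = ρ := by
  cases a
  exacts [hA.correlation i j hij, hA.correlation j i hij.symm]

theorem integrable_pairSize_pow_three (hA : IsEllipticMatrix P ρ M₃ κ A) {i j : Fin n}
    (hij : i ≠ j) : Integrable (fun ω => pairSize (A ω) i j ^ 3) P := by
  have hmem : MemLp (fun ω => pairSize (A ω) i j) 3 P :=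
    (hA.memLp_offDiag i j hij).norm.add (hA.memLp_offDiag j i hij.symm).norm
  simpa only [Real.norm_of_nonneg (pairSize_nonneg _ _ _)] using
    hmem.integrable_norm_pow (by norm_num)

section FiniteMeasure

variable [IsFiniteMeasure P]

theorem integral_decoupledTerm_mul_eq_zero (hA : IsEllipticMatrix P ρ M₃ κ A) (hv : 1 ≤ v)
    (a : Bool) {i j : Fin n} (hij : i ≠ j) (p q : Bool × Fin n)
    {e : Matrix (Fin n) (Fin n) ℝ → ℂ} {L : ℝ} (he : Measurable e) (hL : ∀ B, ‖e B‖ ≤ L) :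
    Integrable (fun ω => decoupledTerm ρ z v a i j p q (orient a (A ω) i j) (orient a (A ω) j i)
        (erasePair i j (A ω)) * e (erasePair i j (A ω))) P ∧
      ∫ ω, decoupledTerm ρ z v a i j p q (orient a (A ω) i j) (orient a (A ω) j i)
        (erasePair i j (A ω)) * e (erasePair i j (A ω)) ∂P = 0 := by
  have hR (B : Matrix (Fin n) (Fin n) ℝ) := norm_hermResolvent_apply_le_one (z := z) hv B
  have hind := hA.indepFun_orient_erasePair a hij
  have herase : Measurable fun ω => erasePair i j (A ω) :=
    (measurable_erasePair i j).comp hA.measurable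
  have hint {φ : Matrix (Fin n) (Fin n) ℝ → ℂ} {c : ℝ} (hφ : Measurable φ)
      (hc : ∀ B, ‖φ B‖ ≤ c) :
      Integrable (fun ω => φ (erasePair i j (A ω)) * e (erasePair i j (A ω))) P :=
    .of_bound ((hφ.mul he).comp herase).aestronglyMeasurable (c * L)
      (ae_of_all _ fun ω => norm_mul_le_of_le (hc _) (hL _))
  have hΦ := measurable_hermResolvent z v p q
  have hT := measurable_pairTerm z v a i j p q
  have hT' := measurable_pairTerm z v a j i p q
  have hzero := integral_smul_secondOrder_eq_zero
    ((hA.memLp_orient a hij).mono_exponent (by norm_num))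
    ((hA.memLp_orient a hij.symm).mono_exponent (by norm_num))
    (hint hΦ fun B => hR B p q) (hint hT fun B => norm_pairTerm_le (hR B) (hR B) a p q)
    (hint hT' fun B => norm_pairTerm_le (hR B) (hR B) a p q)
    (hind.comp measurable_fst (hΦ.mul he)) (hind.comp (measurable_fst.pow_const 2) (hT.mul he))
    (hind.comp (measurable_fst.mul measurable_snd) (hT'.mul he))
    (hA.integral_orient a hij) (hA.integral_orient_sq a hij) (hA.integral_orient_mul_orient a hij)
    (invSqrt n)
  convert hzero using 4 <;>
  · simp only [decoupledTerm, covarianceTerm, Complex.real_smul]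
    ring

theorem integrable_orient (hA : IsEllipticMatrix P ρ M₃ κ A) (a : Bool) (i j : Fin n) :
    Integrable (fun ω => orient a (A ω) i j) P := by
  rcases eq_or_ne i j with rfl | hij
  · cases a <;> exact (hA.memLp_diag i).integrable one_le_two
  · exact (hA.memLp_orient a hij).integrable (by norm_num)

theorem integrable_cumulantTerm_mul (hA : IsEllipticMatrix P ρ M₃ κ A) (hρ : |ρ| ≤ 1) (hv : 1 ≤ v)
    (a : Bool) (i j : Fin n) (p q : Bool × Fin n) {d : Matrix (Fin n) (Fin n) ℝ → ℂ} {L : ℝ}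
    (hd : Measurable d) (hL : ∀ B, ‖d B‖ ≤ L) :
    Integrable (fun ω => cumulantTerm ρ z v a i j p q (A ω) * d (A ω)) P := by
  refine Integrable.mul_bdd (c := L) (.mono' ((hA.integrable_orient a i j).abs.add
    (integrable_const 4)) ?_ (ae_of_all _ fun ω => norm_cumulantTerm_le hρ hv a i j p q (A ω)))
    (hd.comp hA.measurable).aestronglyMeasurable (ae_of_all _ fun ω => hL _)
  exact ((measurable_cumulantTerm ρ z v a i j p q).comp hA.measurable).aestronglyMeasurable

theorem integral_dysonDefect_mul_eq (hA : IsEllipticMatrix P ρ M₃ κ A) (hn : n ≠ 0)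
    (hρ : |ρ| ≤ 1) (hv : 1 ≤ v) (a b : Bool) {d : Matrix (Fin n) (Fin n) ℝ → ℂ} {L : ℝ}
    (hd : Measurable d) (hL : ∀ B, ‖d B‖ ≤ L) :
    ∫ ω, dysonDefect ρ z v (blockTrace z v (A ω)) a b * d (A ω) ∂P =
      (invSqrt n : ℂ) ^ 3 *
        ∑ i, ∑ j, ∫ ω, cumulantTerm ρ z v a i j (!a, j) (b, i) (A ω) * d (A ω) ∂P -
      (invSqrt n : ℂ) ^ 4 *
        ∫ ω, pairRemainder ρ a b (hermResolvent z v (A ω)) * d (A ω) ∂P := by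
  have hrem :
      Integrable (fun ω => pairRemainder ρ a b (hermResolvent z v (A ω)) * d (A ω)) P :=
    .of_bound (((measurable_pairRemainder ρ z v a b).mul hd).comp
      hA.measurable).aestronglyMeasurable (2 * n * L) (ae_of_all _ fun ω =>
        norm_mul_le_of_le (norm_pairRemainder_le hρ hv a b (A ω)) (hL _))
  have hterm (i j : Fin n) :=
    hA.integrable_cumulantTerm_mul (z := z) hρ hv a i j (!a, j) (b, i) hd hL
  have hrow (i : Fin n) := integrable_finsetSum Finset.univ fun j _ => hterm i j
  simp only [dysonDefect_blockTrace_eq_sum_cumulantTerm hn (zero_lt_one.trans_le hv).ne', sub_mul,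
    mul_assoc, Finset.sum_mul]
  rw [integral_sub ((integrable_finsetSum _ fun i _ => hrow i).const_mul _) (hrem.const_mul _),
    integral_const_mul, integral_const_mul, integral_finsetSum _ fun i _ => hrow i]
  simp only [integral_finsetSum _ fun j _ => hterm _ j]

end FiniteMeasure

variable [IsProbabilityMeasure P]

theorem integral_one_add_pairSize_pow_three_le (hA : IsEllipticMatrix P ρ M₃ κ A) {i j : Fin n}
    (hij : i ≠ j) : ∫ ω, (1 + pairSize (A ω) i j ^ 3) ∂P ≤ 1 + 8 * (M₃ : ℝ) := by
  have habs {k l : Fin n} (hkl : k ≠ l) : Integrable (fun ω => |A ω k l| ^ 3) P :=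
    (hA.memLp_offDiag k l hkl).integrable_norm_pow (by norm_num)
  have hsum : Integrable (fun ω => 4 * (|A ω i j| ^ 3 + |A ω j i| ^ 3)) P :=
    ((habs hij).add (habs hij.symm)).const_mul 4
  have hcube (x y : ℝ) (hx : 0 ≤ x) (hy : 0 ≤ y) : (x + y) ^ 3 ≤ 4 * (x ^ 3 + y ^ 3) := by
    nlinarith [mul_nonneg (add_nonneg hx hy) (sq_nonneg (x - y))]
  calc ∫ ω, (1 + pairSize (A ω) i j ^ 3) ∂P
      ≤ ∫ ω, (1 + 4 * (|A ω i j| ^ 3 + |A ω j i| ^ 3)) ∂P :=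
        integral_mono ((integrable_const 1).add (hA.integrable_pairSize_pow_three hij))
          ((integrable_const 1).add hsum) fun ω => add_le_add le_rfl
            (hcube _ _ (abs_nonneg _) (abs_nonneg _))
    _ = 1 + 4 * (∫ ω, |A ω i j| ^ 3 ∂P + ∫ ω, |A ω j i| ^ 3 ∂P) := by
        rw [integral_add (integrable_const 1) hsum, integral_const_mul,
          integral_add (habs hij) (habs hij.symm)]
        simp
    _ ≤ 1 + 8 * M₃ := by
        linarith [hA.third_moment_offDiag_le i j hij, hA.third_moment_offDiag_le j i hij.symm]

theorem norm_integral_cumulantTerm_mul_le_of_ne (hA : IsEllipticMatrix P ρ M₃ κ A) (hρ : |ρ| ≤ 1)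
    (hv : 1 ≤ v) (a : Bool) {i j : Fin n} (hij : i ≠ j) (p q : Bool × Fin n)
    {d : Matrix (Fin n) (Fin n) ℝ → ℂ} {L : ℝ} (hd : Measurable d) (hL : ∀ B, ‖d B‖ ≤ L)
    (hdiff : ∀ B, ‖d B - d (erasePair i j B)‖ ≤ L * (2 * (invSqrt n ^ 3 * pairSize B i j))) :
    ‖∫ ω, cumulantTerm ρ z v a i j p q (A ω) * d (A ω) ∂P‖ ≤
      30 * L * invSqrt n ^ 2 * (1 + 8 * M₃) := by
  obtain ⟨hint, hzero⟩ := hA.integral_decoupledTerm_mul_eq_zero (z := z) hv a hij p q hd hL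
  have hL₀ : 0 ≤ L := (norm_nonneg _).trans (hL 0)
  rw [← sub_zero (∫ ω, _ ∂P), ← hzero,
    ← integral_sub (hA.integrable_cumulantTerm_mul hρ hv a i j p q hd hL) hint]
  refine (norm_integral_le_of_norm_le
    (((integrable_const 1).add (hA.integrable_pairSize_pow_three hij)).const_mul
      (30 * L * invSqrt n ^ 2)) (ae_of_all _ fun ω =>
        norm_cumulantTerm_mul_sub_decoupledTerm_mul_le hρ hv (A ω) a hij p q (hL _) (hL _)
          (hdiff _))).trans ?_
  rw [integral_const_mul]
  exact mul_le_mul_of_nonneg_left (hA.integral_one_add_pairSize_pow_three_le hij) (by positivity)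

theorem norm_integral_cumulantTerm_mul_le_self (hA : IsEllipticMatrix P ρ M₃ κ A) (hρ : |ρ| ≤ 1)
    (hv : 1 ≤ v) (a : Bool) (i : Fin n) (p q : Bool × Fin n)
    {d : Matrix (Fin n) (Fin n) ℝ → ℂ} {L : ℝ} (hL : ∀ B, ‖d B‖ ≤ L) :
    ‖∫ ω, cumulantTerm ρ z v a i i p q (A ω) * d (A ω) ∂P‖ ≤ L * (κ + 5) := by
  have hL₀ : 0 ≤ L := (norm_nonneg _).trans (hL 0)
  have hsq : Integrable (fun ω => A ω i i ^ 2) P := (hA.memLp_diag i).integrable_sq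
  have hbound (ω : Ω) :
      ‖cumulantTerm ρ z v a i i p q (A ω) * d (A ω)‖ ≤ L * (A ω i i ^ 2 + 5) := by
    have horient : orient a (A ω) i i = A ω i i := by cases a <;> rfl
    have hterm := norm_cumulantTerm_le (z := z) hρ hv a i i p q (A ω)
    rw [horient] at hterm
    rw [mul_comm L]
    refine norm_mul_le_of_le (hterm.trans ?_) (hL _)
    nlinarith [sq_abs (A ω i i), sq_nonneg (|A ω i i| - 1)]
  calc ‖∫ ω, cumulantTerm ρ z v a i i p q (A ω) * d (A ω) ∂P‖
      ≤ ∫ ω, L * (A ω i i ^ 2 + 5) ∂P := norm_integral_le_of_norm_le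
        ((hsq.add (integrable_const 5)).const_mul L) (ae_of_all _ hbound)
    _ = L * (∫ ω, A ω i i ^ 2 ∂P + 5) := by
        rw [integral_const_mul, integral_add hsq (integrable_const 5)]
        simp
    _ ≤ L * (κ + 5) := by
        gcongr
        exact hA.second_moment_diag_le i

theorem norm_sum_integral_cumulantTerm_mul_le (hA : IsEllipticMatrix P ρ M₃ κ A) (hρ : |ρ| ≤ 1)
    (hv : 1 ≤ v) (a b : Bool) {d : Matrix (Fin n) (Fin n) ℝ → ℂ} {L : ℝ} (hd : Measurable d)
    (hL : ∀ B, ‖d B‖ ≤ L) (hdiff : ∀ i j, i ≠ j → ∀ B,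
      ‖d B - d (erasePair i j B)‖ ≤ L * (2 * (invSqrt n ^ 3 * pairSize B i j))) :
    ‖∑ i, ∑ j, ∫ ω, cumulantTerm ρ z v a i j (!a, j) (b, i) (A ω) * d (A ω) ∂P‖ ≤
      n * (L * (κ + 5)) + n * (n * (30 * L * invSqrt n ^ 2 * (1 + 8 * M₃))) := by
  have hL₀ : 0 ≤ L := (norm_nonneg _).trans (hL 0)
  have hoff : 0 ≤ 30 * L * invSqrt n ^ 2 * (1 + 8 * M₃) := by positivity
  have hentry (i j : Fin n) :
      ‖∫ ω, cumulantTerm ρ z v a i j (!a, j) (b, i) (A ω) * d (A ω) ∂P‖ ≤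
        (if i = j then L * (κ + 5) else 0) + 30 * L * invSqrt n ^ 2 * (1 + 8 * M₃) := by
    split_ifs with hij
    · subst hij
      exact (hA.norm_integral_cumulantTerm_mul_le_self hρ hv a i _ _ hL).trans
        (le_add_of_nonneg_right hoff)
    · rw [zero_add]
      exact hA.norm_integral_cumulantTerm_mul_le_of_ne hρ hv a hij _ _ hd hL (hdiff i j hij)
  refine (norm_sum_le_of_le _ fun i _ => norm_sum_le_of_le _ fun j _ => hentry i j).trans_eq ?_
  simp only [Finset.sum_add_distrib, Finset.sum_ite_eq, Finset.mem_univ, if_true, Finset.sum_const,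
    Finset.card_univ, Fintype.card_fin, nsmul_eq_mul]

theorem norm_integral_dysonDefect_mul_le (hA : IsEllipticMatrix P ρ M₃ κ A) (hn : n ≠ 0)
    (hρ : |ρ| ≤ 1) (hv : 1 ≤ v) (a b : Bool) {d : Matrix (Fin n) (Fin n) ℝ → ℂ} {L : ℝ}
    (hd : Measurable d) (hL : ∀ B, ‖d B‖ ≤ L) (hdiff : ∀ i j, i ≠ j → ∀ B,
      ‖d B - d (erasePair i j B)‖ ≤ L * (2 * (invSqrt n ^ 3 * pairSize B i j))) :
    ‖∫ ω, dysonDefect ρ z v (blockTrace z v (A ω)) a b * d (A ω) ∂P‖ ≤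
      L * (240 * M₃ + κ + 37) * invSqrt n := by
  have hL₀ : 0 ≤ L := (norm_nonneg _).trans (hL 0)
  have hs := invSqrt_nonneg n
  have hns : n * invSqrt n ^ 2 = 1 := by
    rw [invSqrt_sq, mul_inv_cancel₀ (Nat.cast_ne_zero.2 hn)]
  have hrem : ‖∫ ω, pairRemainder ρ a b (hermResolvent z v (A ω)) * d (A ω) ∂P‖ ≤ 2 * n * L := by
    simpa using norm_integral_le_of_norm_le_const (ae_of_all P fun ω =>
      norm_mul_le_of_le (norm_pairRemainder_le hρ hv a b (A ω)) (hL (A ω)))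
  have hpow (k : ℕ) : ‖(invSqrt n : ℂ) ^ k‖ ≤ invSqrt n ^ k := by
    rw [norm_pow, Complex.norm_real, Real.norm_of_nonneg hs]
  rw [hA.integral_dysonDefect_mul_eq hn hρ hv a b hd hL]
  calc _ ≤ invSqrt n ^ 3 * (n * (L * (κ + 5)) +
          n * (n * (30 * L * invSqrt n ^ 2 * (1 + 8 * M₃)))) + invSqrt n ^ 4 * (2 * n * L) :=
        norm_sub_le_of_le (norm_mul_le_of_le (hpow 3)
          (hA.norm_sum_integral_cumulantTerm_mul_le hρ hv a b hd hL hdiff))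
          (norm_mul_le_of_le (hpow 4) hrem)
    _ = L * (κ + 5 + 30 * (1 + 8 * M₃) + 2 * invSqrt n) * invSqrt n := by
        linear_combination (L * invSqrt n * (κ + 5 + 2 * invSqrt n) +
          30 * L * invSqrt n * (1 + 8 * M₃) * (n * invSqrt n ^ 2 + 1)) * hns
    _ ≤ L * (240 * M₃ + κ + 37) * invSqrt n := by
        refine mul_le_mul_of_nonneg_right (mul_le_mul_of_nonneg_left ?_ hL₀) hs
        linarith [invSqrt_le_one n]

theorem integral_norm_dysonDefect_sq_le (hA : IsEllipticMatrix P ρ M₃ κ A) (hn : n ≠ 0)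
    (hρ : |ρ| ≤ 1) (hv : 1 ≤ v) (a b : Bool) :
    ∫ ω, ‖dysonDefect ρ z v (blockTrace z v (A ω)) a b‖ ^ 2 ∂P ≤
      (‖z‖ + 4 + v) * (240 * M₃ + κ + 37) * invSqrt n := by
  have hv₀ := zero_le_one.trans hv
  have htrace := norm_blockTrace_le_one (n := n) (z := z) hv
  have hD (B : Matrix (Fin n) (Fin n) ℝ) :
      ‖conj (dysonDefect ρ z v (blockTrace z v B) a b)‖ ≤ ‖z‖ + 4 + v := by
    rw [RCLike.norm_conj]
    exact (norm_apply_apply_le _ a b).trans (norm_dysonDefect_le hρ z hv₀ (htrace B))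
  have hdiff (i j : Fin n) (hij : i ≠ j) (B : Matrix (Fin n) (Fin n) ℝ) :
      ‖conj (dysonDefect ρ z v (blockTrace z v B) a b) -
          conj (dysonDefect ρ z v (blockTrace z v (erasePair i j B)) a b)‖ ≤
        (‖z‖ + 4 + v) * (2 * (invSqrt n ^ 3 * pairSize B i j)) := by
    rw [← map_sub, RCLike.norm_conj]
    exact (norm_apply_apply_le (dysonDefect ρ z v (blockTrace z v B) -
        dysonDefect ρ z v (blockTrace z v (erasePair i j B))) a b).trans
      ((norm_dysonDefect_sub_le hρ z hv₀ (htrace _) (htrace _)).trans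
        (mul_le_mul_of_nonneg_left (norm_blockTrace_sub_erasePair_le hv B hij) (by positivity)))
  have hbound := hA.norm_integral_dysonDefect_mul_le (z := z) hn hρ hv a b
    (Complex.continuous_conj.measurable.comp (measurable_dysonDefect_blockTrace ρ z v a b)) hD hdiff
  simp only [Function.comp_apply, Complex.mul_conj', ← Complex.ofReal_pow, integral_complex_ofReal,
    Complex.norm_real] at hbound
  exact (le_abs_self _).trans hbound

end IsEllipticMatrix

section Independence

variable {Ω : Type*} [MeasurableSpace Ω] {P : Measure Ω}

theorem indepFun_prodMk_of_indepFun_prodMk [IsFiniteMeasure P] {α β γ : Type*} [MeasurableSpace α]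
    [MeasurableSpace β] [MeasurableSpace γ] {U : Ω → α} {V : Ω → β} {W : Ω → γ}
    (hU : Measurable U) (hV : Measurable V) (hW : Measurable W) (hUV : IndepFun U V P)
    (hUVW : IndepFun (fun ω => (U ω, V ω)) W P) : IndepFun U (fun ω => (V ω, W ω)) P := by
  have hVW : IndepFun V W P := hUVW.comp measurable_snd measurable_id
  rw [indepFun_iff_map_prod_eq_prod_map_map hU.aemeasurable (hV.prodMk hW).aemeasurable,
    (indepFun_iff_map_prod_eq_prod_map_map hV.aemeasurable hW.aemeasurable).1 hVW,
    ← Measure.prodAssoc_prod,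
    ← (indepFun_iff_map_prod_eq_prod_map_map hU.aemeasurable hV.aemeasurable).1 hUV,
    ← (indepFun_iff_map_prod_eq_prod_map_map (hU.prodMk hV).aemeasurable hW.aemeasurable).1 hUVW,
    Measure.map_map (MeasurableEquiv.measurable _) ((hU.prodMk hV).prodMk hW)]
  rfl

theorem indepFun_update_of_iIndepFun {ι β : Type*} [Finite ι] [DecidableEq ι] [MeasurableSpace β]
    {f : ι → Ω → β} (hind : iIndepFun f P) (hf : ∀ i, Measurable (f i)) (i : ι) (c : β) :
    IndepFun (f i) (fun ω => Function.update (fun j => f j ω) i c) P := by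
  cases nonempty_fintype ι
  let extend (x : ({i}ᶜ : Finset ι) → β) (j : ι) : β :=
    if hj : j ∈ ({i}ᶜ : Finset ι) then x ⟨j, hj⟩ else c
  have hextend : Measurable extend := measurable_pi_lambda _ fun j => by
    by_cases hj : j ∈ ({i}ᶜ : Finset ι)
    · simp only [extend, dif_pos hj]
      exact measurable_pi_apply _
    · simp only [extend, dif_neg hj, measurable_const]
  have hvalue : Measurable fun x : ({i} : Finset ι) → β => x ⟨i, Finset.mem_singleton_self i⟩ :=
    measurable_pi_apply _
  have hupdate : (fun ω => Function.update (fun j => f j ω) i c) =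
      extend ∘ fun ω (j : ({i}ᶜ : Finset ι)) => f j ω := by
    ext ω j
    simp [extend, Function.update_apply]
  rw [hupdate]
  exact (hind.indepFun_finset {i} {i}ᶜ disjoint_compl_right hf).comp hvalue hextend

end Independence

section ConditionC0

/-- The matrix whose entries at `(i, j)` and `(j, i)`, for `i < j`, are the components of `x (i, j)`
and whose diagonal is `y`. -/
def matrixOfPairs {n : ℕ} (x : {p : Fin n × Fin n // p.1 < p.2} → ℝ × ℝ) (y : Fin n → ℝ) :
    Matrix (Fin n) (Fin n) ℝ :=
  Matrix.of fun k l => if hkl : k < l then (x ⟨(k, l), hkl⟩).1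
    else if hlk : l < k then (x ⟨(l, k), hlk⟩).2 else y k

theorem measurable_matrixOfPairs {n : ℕ} : Measurable fun
    x : ({p : Fin n × Fin n // p.1 < p.2} → ℝ × ℝ) × (Fin n → ℝ) => matrixOfPairs x.1 x.2 := by
  refine measurable_matrix_of_apply fun k l => ?_
  simp only [matrixOfPairs, Matrix.of_apply]
  split_ifs
  · exact ((measurable_pi_apply _).comp measurable_fst).fst
  · exact ((measurable_pi_apply _).comp measurable_fst).snd
  · exact (measurable_pi_apply _).comp measurable_snd

theorem erasePair_eq_matrixOfPairs {n : ℕ} (A : Matrix (Fin n) (Fin n) ℝ) {i j : Fin n}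
    (hij : i < j) : erasePair i j A = matrixOfPairs
      (Function.update (fun p => (A p.1.1 p.1.2, A p.1.2 p.1.1)) ⟨(i, j), hij⟩ 0)
      fun k => A k k := by
  ext k l
  simp only [erasePair, matrixOfPairs, Matrix.of_apply, Function.update_apply, Subtype.mk.injEq,
    Prod.mk.injEq, Sym2.eq_iff, apply_ite Prod.fst, apply_ite Prod.snd, Prod.fst_zero,
    Prod.snd_zero]
  rcases lt_trichotomy k l with h | rfl | h
  · grind
  · grind
  · grind

namespace ConditionC0

variable {Ω : Type*} [MeasurableSpace Ω] {P : Measure Ω} [IsProbabilityMeasure P] {ρ M₄ : ℝ}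
  {X : (n : ℕ) → Fin n → Fin n → Ω → ℝ}

theorem indepFun_erasePair_of_lt (hX : ConditionC0 P ρ M₄ X) {n : ℕ} {i j : Fin n} (hij : i < j) :
    IndepFun (fun ω => (X n i j ω, X n j i ω))
      (fun ω => erasePair i j (Matrix.of fun k l => X n k l ω)) P := by
  let pair (p : {p : Fin n × Fin n // p.1 < p.2}) (ω : Ω) : ℝ × ℝ :=
    (X n p.1.1 p.1.2 ω, X n p.1.2 p.1.1 ω)
  let p₀ : {p : Fin n × Fin n // p.1 < p.2} := ⟨(i, j), hij⟩
  let otherPairs (ω : Ω) := Function.update (fun p => pair p ω) p₀ 0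
  let diag (ω : Ω) (k : Fin n) : ℝ := X n k k ω
  have hpair (p) : Measurable (pair p) := (hX.measurable n _ _).prodMk (hX.measurable n _ _)
  have hother : Measurable otherPairs :=
    measurable_update_left.comp (measurable_pi_lambda _ hpair)
  have hdiag : Measurable diag := measurable_pi_lambda _ fun k => hX.measurable n k k
  have hpair_other : IndepFun (pair p₀) otherPairs P :=
    indepFun_update_of_iIndepFun (hX.indep_pairs n) hpair p₀ 0
  have hoffDiag_diag : IndepFun (fun ω => (pair p₀ ω, otherPairs ω)) diag P := by
    let pairOf (f : {p : Fin n × Fin n // p.1 ≠ p.2} → ℝ)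
        (p : {p : Fin n × Fin n // p.1 < p.2}) : ℝ × ℝ :=
      (f ⟨p.1, p.2.ne⟩, f ⟨p.1.swap, p.2.ne'⟩)
    have hpairOf : Measurable pairOf := measurable_pi_lambda _ fun p =>
      (measurable_pi_apply _).prodMk (measurable_pi_apply _)
    exact (hX.indep_diag_offDiag n).symm.comp (φ := fun f =>
      (pairOf f p₀, Function.update (pairOf f) p₀ 0))
      (((measurable_pi_apply p₀).comp hpairOf).prodMk (measurable_update_left.comp hpairOf))
      measurable_id
  have hind := indepFun_prodMk_of_indepFun_prodMk (hpair p₀) hother hdiag hpair_other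
    hoffDiag_diag
  simp only [erasePair_eq_matrixOfPairs _ hij]
  exact hind.comp measurable_id measurable_matrixOfPairs

theorem indepFun_erasePair (hX : ConditionC0 P ρ M₄ X) {n : ℕ} {i j : Fin n} (hij : i ≠ j) :
    IndepFun (fun ω => (X n i j ω, X n j i ω))
      (fun ω => erasePair i j (Matrix.of fun k l => X n k l ω)) P := by
  rcases hij.lt_or_gt with hlt | hgt
  · exact hX.indepFun_erasePair_of_lt hlt
  · simp only [erasePair_comm i j]
    exact (hX.indepFun_erasePair_of_lt hgt).comp measurable_swap measurable_id

theorem integral_abs_pow_three_le (hX : ConditionC0 P ρ M₄ X) {n : ℕ} {i j : Fin n} (hij : i ≠ j) :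
    ∫ ω, |X n i j ω| ^ 3 ∂P ≤ 1 + M₄ := by
  have hmem := hX.memLp_offDiag n i j hij
  have hint₃ : Integrable (fun ω => |X n i j ω| ^ 3) P :=
    (hmem.mono_exponent (by norm_num)).integrable_norm_pow (p := 3) (by norm_num)
  have hint₄ : Integrable (fun ω => |X n i j ω| ^ 4) P := hmem.integrable_norm_pow (by norm_num)
  have hpow (x : ℝ) : |x| ^ 3 ≤ 1 + |x| ^ 4 := by
    nlinarith [sq_nonneg (|x| ^ 2 - |x|), sq_nonneg (|x| - 1), abs_nonneg x]
  calc ∫ ω, |X n i j ω| ^ 3 ∂P ≤ ∫ ω, (1 + |X n i j ω| ^ 4) ∂P :=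
        integral_mono hint₃ ((integrable_const 1).add hint₄) fun ω => hpow _
    _ = 1 + ∫ ω, |X n i j ω| ^ 4 ∂P := by
        rw [integral_add (integrable_const 1) hint₄]
        simp
    _ ≤ 1 + M₄ := by gcongr; exact hX.fourth_moment_offDiag n i j hij

theorem isEllipticMatrix (hX : ConditionC0 P ρ M₄ X) (n : ℕ) :
    IsEllipticMatrix P ρ (1 + M₄.toNNReal) (∫ ω, X 1 0 0 ω ^ 2 ∂P).toNNReal
      fun ω => Matrix.of fun i j => X n i j ω where
  measurable := measurable_matrix_of_apply fun i j => hX.measurable n i j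
  indepFun_erasePair _ _ hij := hX.indepFun_erasePair hij
  memLp_offDiag i j hij := (hX.memLp_offDiag n i j hij).mono_exponent (by norm_num)
  mean_offDiag := hX.mean_offDiag n
  variance_offDiag := hX.variance_offDiag n
  correlation := hX.correlation n
  third_moment_offDiag_le i j hij := by
    refine (hX.integral_abs_pow_three_le hij).trans ?_
    push_cast
    exact add_le_add le_rfl (Real.le_coe_toNNReal M₄)
  memLp_diag := hX.memLp_diag n
  second_moment_diag_le i := by
    refine le_trans (le_of_eq ?_) (Real.le_coe_toNNReal _)
    exact ((hX.ident_diag n 1 i 0).comp (measurable_id.pow_const 2)).integral_eq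

end ConditionC0

end ConditionC0

section SingularValues

variable {n : ℕ}

theorem sum_inner_toEuclideanLin_orthonormalBasis (M : Matrix (Fin n) (Fin n) ℂ)
    (b : OrthonormalBasis (Fin n) ℂ (EuclideanSpace ℂ (Fin n))) :
    ∑ i, inner ℂ (b i) (Matrix.toEuclideanLin M (b i)) = M.trace := by
  rw [← LinearMap.trace_eq_sum_inner _ b, Matrix.toEuclideanLin_eq_toLin_orthonormal,
    Matrix.trace_toLin_eq]

theorem toEuclideanLin_conjTranspose_mul_self (W : Matrix (Fin n) (Fin n) ℂ) :
    Matrix.toEuclideanLin (W.conjTranspose * W) =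
      LinearMap.adjoint (Matrix.toEuclideanLin W) ∘ₗ Matrix.toEuclideanLin W := by
  rw [← Matrix.toEuclideanLin_conjTranspose_eq_adjoint, Matrix.toLpLin_mul_same]

theorem exists_orthonormalBasis_adjoint_comp_self_apply (W : Matrix (Fin n) (Fin n) ℂ) :
    ∃ b : OrthonormalBasis (Fin n) ℂ (EuclideanSpace ℂ (Fin n)), ∀ i,
      Matrix.toEuclideanLin (W.conjTranspose * W) (b i) =
        (((Matrix.toEuclideanLin W).singularValues i ^ 2 : ℝ) : ℂ) • b i := by
  have hfinrank : Module.finrank ℂ (EuclideanSpace ℂ (Fin n)) = n := finrank_euclideanSpace_fin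
  have hsymm := (Matrix.toEuclideanLin W).isSymmetric_adjoint_comp_self
  refine ⟨hsymm.eigenvectorBasis hfinrank, fun i => ?_⟩
  rw [toEuclideanLin_conjTranspose_mul_self, hsymm.apply_eigenvectorBasis hfinrank i,
    LinearMap.sq_singularValues_fin _ hfinrank i]
  rfl

theorem sum_sq_singularValues (W : Matrix (Fin n) (Fin n) ℂ) :
    ∑ i : Fin n, (Matrix.toEuclideanLin W).singularValues i ^ 2 = ∑ i, ∑ j, ‖W i j‖ ^ 2 := by
  obtain ⟨b, hb⟩ := exists_orthonormalBasis_adjoint_comp_self_apply W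
  have htrace := sum_inner_toEuclideanLin_orthonormalBasis (W.conjTranspose * W) b
  simp only [hb, inner_smul_right, orthonormal_iff_ite.1 b.orthonormal, if_true, mul_one,
    Matrix.trace, Matrix.diag_apply, Matrix.mul_apply, Matrix.conjTranspose_apply,
    RCLike.star_def, Complex.conj_mul'] at htrace
  rw [Finset.sum_comm]
  exact_mod_cast htrace

theorem trace_eq_sum_div_of_conjTranspose_mul_self_mul {W Q : Matrix (Fin n) (Fin n) ℂ} {c : ℂ}
    {w : ℝ} (hw : 0 < w) (hQ : W.conjTranspose * W * Q = c • 1 - (w : ℂ) • Q) :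
    Q.trace = ∑ i : Fin n, c / (((Matrix.toEuclideanLin W).singularValues i ^ 2 + w : ℝ) : ℂ) := by
  obtain ⟨b, hb⟩ := exists_orthonormalBasis_adjoint_comp_self_apply W
  rw [← sum_inner_toEuclideanLin_orthonormalBasis Q b]
  refine Finset.sum_congr rfl fun i _ => ?_
  set s := (Matrix.toEuclideanLin W).singularValues i
  have hsw : ((s ^ 2 + w : ℝ) : ℂ) ≠ 0 := by
    exact_mod_cast (add_pos_of_nonneg_of_pos (sq_nonneg s) hw).ne'
  have hsymm : inner ℂ (b i) (Matrix.toEuclideanLin (W.conjTranspose * W * Q) (b i)) =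
      ((s ^ 2 : ℝ) : ℂ) * inner ℂ (b i) (Matrix.toEuclideanLin Q (b i)) := by
    rw [Matrix.toLpLin_mul_same, LinearMap.comp_apply, toEuclideanLin_conjTranspose_mul_self,
      ← (Matrix.toEuclideanLin W).isSymmetric_adjoint_comp_self (b i),
      ← toEuclideanLin_conjTranspose_mul_self, hb, inner_smul_left, Complex.conj_ofReal]
  rw [hQ, map_sub, map_smul, map_smul, Matrix.toLpLin_one, LinearMap.sub_apply,
    LinearMap.smul_apply, LinearMap.smul_apply, LinearMap.id_apply, inner_sub_right,
    inner_smul_right, inner_smul_right, orthonormal_iff_ite.1 b.orthonormal i i, if_pos rfl,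
    mul_one] at hsymm
  rw [eq_div_iff hsw]
  push_cast at hsymm ⊢
  linear_combination -hsymm

theorem hermitization_mul_apply_false (W : Matrix (Fin n) (Fin n) ℂ)
    (R : Matrix (Bool × Fin n) (Bool × Fin n) ℂ) (k : Fin n) (q : Bool × Fin n) :
    (hermitization W * R) (false, k) q = ∑ l, W k l * R (true, l) q := by
  simp [Matrix.mul_apply, Fintype.sum_prod_type, hermitization]

theorem hermitization_mul_apply_true (W : Matrix (Fin n) (Fin n) ℂ)
    (R : Matrix (Bool × Fin n) (Bool × Fin n) ℂ) (k : Fin n) (q : Bool × Fin n) :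
    (hermitization W * R) (true, k) q = ∑ l, conj (W l k) * R (false, l) q := by
  simp [Matrix.mul_apply, Fintype.sum_prod_type, hermitization]

theorem conjTranspose_mul_self_mul_submatrix_imagResolvent (W : Matrix (Fin n) (Fin n) ℂ) {v : ℝ}
    (hv : v ≠ 0) :
    let Q := (imagResolvent (hermitization W) v).submatrix (Prod.mk true) (Prod.mk true)
    W.conjTranspose * W * Q = (Complex.I * v) • 1 - ((v ^ 2 : ℝ) : ℂ) • Q := by
  intro Q
  let Q' := (imagResolvent (hermitization W) v).submatrix (Prod.mk false) (Prod.mk true)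
  have hmul := sub_imag_mul_imagResolvent (isHermitian_hermitization W) hv
  rw [sub_mul, sub_eq_iff_eq_add, smul_mul_assoc, one_mul] at hmul
  have hfalse : W * Q = (Complex.I * v) • Q' := by
    ext k l
    refine (hermitization_mul_apply_false W (imagResolvent _ v) k (true, l)).symm.trans ?_
    simp [hmul, Q']
  have htrue : W.conjTranspose * Q' = 1 + (Complex.I * v) • Q := by
    ext k l
    refine (hermitization_mul_apply_true W (imagResolvent _ v) k (true, l)).symm.trans ?_
    simp [hmul, Q, Matrix.one_apply]
  have hsq : (Complex.I * v) * (Complex.I * v) = -((v ^ 2 : ℝ) : ℂ) := by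
    push_cast
    linear_combination (v : ℂ) ^ 2 * Complex.I_sq
  rw [mul_assoc, hfalse, mul_smul_comm, htrue, smul_add, smul_smul, hsq, neg_smul, sub_eq_add_neg]

theorem sum_imagResolvent_hermitization (W : Matrix (Fin n) (Fin n) ℂ) {v : ℝ} (hv : v ≠ 0) :
    ∑ k, imagResolvent (hermitization W) v (true, k) (true, k) = Complex.I * v *
      ((∑ i : Fin n, ((Matrix.toEuclideanLin W).singularValues i ^ 2 + v ^ 2)⁻¹ : ℝ) : ℂ) := by
  have htrace := trace_eq_sum_div_of_conjTranspose_mul_self_mul (sq_pos_of_ne_zero hv)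
    (conjTranspose_mul_self_mul_submatrix_imagResolvent W hv)
  simp only [Matrix.trace, Matrix.diag_apply, Matrix.submatrix_apply] at htrace
  rw [htrace, Complex.ofReal_sum, Finset.mul_sum]
  simp only [div_eq_mul_inv, Complex.ofReal_inv]

end SingularValues

section SingularValueLaw

variable {n : ℕ}

theorem isProbabilityMeasure_inv_smul_sum_dirac {α : Type*} [MeasurableSpace α] (hn : n ≠ 0)
    (x : Fin n → α) :
    IsProbabilityMeasure ((n : ℝ≥0∞)⁻¹ • ∑ i : Fin n, Measure.dirac (x i)) := ⟨by
  simp only [Measure.smul_apply, Measure.finsetSum_apply, measure_univ, Finset.sum_const,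
    Finset.card_univ, Fintype.card_fin, nsmul_eq_mul, mul_one, smul_eq_mul]
  exact ENNReal.inv_mul_cancel (Nat.cast_ne_zero.2 hn) (ENNReal.natCast_ne_top n)⟩

/-- The empirical law of the singular values of `W` as a probability measure on `[0, ∞)`, where
`singularValueMeasure W` lives on `ℝ`. In dimension zero it is the point mass at `0`, so that it is
always a probability measure. -/
noncomputable def singularValueLaw (W : Matrix (Fin n) (Fin n) ℂ) : ProbabilityMeasure ℝ≥0 :=
  if hn : n = 0 then diracProba 0 else
    ⟨(n : ℝ≥0∞)⁻¹ • ∑ i : Fin n,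
      Measure.dirac ((Matrix.toEuclideanLin W).singularValues i).toNNReal,
      isProbabilityMeasure_inv_smul_sum_dirac hn _⟩

theorem coe_singularValueLaw (hn : n ≠ 0) (W : Matrix (Fin n) (Fin n) ℂ) :
    (singularValueLaw W : Measure ℝ≥0) = (n : ℝ≥0∞)⁻¹ • ∑ i : Fin n,
      Measure.dirac ((Matrix.toEuclideanLin W).singularValues i).toNNReal :=
  congrArg (fun μ : ProbabilityMeasure ℝ≥0 => (μ : Measure ℝ≥0)) (dif_neg hn)

theorem map_singularValueLaw (hn : n ≠ 0) (W : Matrix (Fin n) (Fin n) ℂ) :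
    (singularValueLaw W : Measure ℝ≥0).map ((↑) : ℝ≥0 → ℝ) = singularValueMeasure W := by
  have hm : Measurable ((↑) : ℝ≥0 → ℝ) := measurable_coe_nnreal_real
  rw [coe_singularValueLaw hn, singularValueMeasure, Measure.map_smul,
    Measure.map_finset_sum hm.aemeasurable]
  simp only [Measure.map_dirac' hm, Real.coe_toNNReal _ (LinearMap.singularValues_nonneg _ _)]

theorem singularValueLaw_mem_secondMomentLE (W : Matrix (Fin n) (Fin n) ℂ) {C : ℝ≥0}
    (h : (n : ℝ)⁻¹ * ∑ i, ∑ j, ‖W i j‖ ^ 2 ≤ C) : singularValueLaw W ∈ secondMomentLE C := by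
  change ∫⁻ x : ℝ≥0, (x : ℝ≥0∞) ^ 2 ∂(singularValueLaw W : Measure ℝ≥0) ≤ C
  rcases eq_or_ne n 0 with rfl | hn
  · simp [singularValueLaw, diracProba]
  rw [← sum_sq_singularValues] at h
  have hNNReal : (n : ℝ≥0)⁻¹ * ∑ i : Fin n,
      ((Matrix.toEuclideanLin W).singularValues i).toNNReal ^ 2 ≤ C := by
    rw [← NNReal.coe_le_coe]
    push_cast
    simpa only [Real.coe_toNNReal _ (LinearMap.singularValues_nonneg _ _)] using h
  rw [coe_singularValueLaw hn, lintegral_smul_measure, lintegral_finsetSum_measure]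
  simp only [lintegral_dirac, smul_eq_mul]
  simpa only [ENNReal.coe_mul, ENNReal.coe_inv (Nat.cast_ne_zero.2 hn), ENNReal.coe_natCast,
    ENNReal.ofNNReal_finsetSum, ENNReal.coe_pow] using ENNReal.coe_le_coe.2 hNNReal

theorem invSqTransform_singularValueLaw (hn : n ≠ 0) (W : Matrix (Fin n) (Fin n) ℂ) (t : ℝ) :
    invSqTransform (singularValueLaw W) t =
      (n : ℝ)⁻¹ * ∑ i : Fin n, ((Matrix.toEuclideanLin W).singularValues i ^ 2 + t)⁻¹ := by
  rw [invSqTransform, coe_singularValueLaw hn, integral_smul_measure,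
    integral_finsetSum_measure fun i _ => integrable_dirac (by simp)]
  simp [Real.coe_toNNReal _ (LinearMap.singularValues_nonneg _ _)]

theorem invSqTransform_singularValueLaw_shiftedMatrix (hn : n ≠ 0) (A : Matrix (Fin n) (Fin n) ℝ)
    (z : ℂ) {v : ℝ} (hv : v ≠ 0) :
    invSqTransform (singularValueLaw (shiftedMatrix A z)) (v ^ 2) =
      (blockTrace z v A true true).im / v := by
  rw [invSqTransform_singularValueLaw hn, eq_div_iff hv, blockTrace]
  simp only [hermResolvent, shiftedHerm]
  rw [sum_imagResolvent_hermitization _ hv, ← Complex.ofReal_natCast, ← Complex.ofReal_inv,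
    Complex.im_ofReal_mul, mul_assoc Complex.I, Complex.I_mul_im, Complex.re_ofReal_mul,
    Complex.ofReal_re]
  ring

theorem norm_shiftedMatrix_apply_sq_le (A : Matrix (Fin n) (Fin n) ℝ) (z : ℂ) (i j : Fin n) :
    ‖shiftedMatrix A z i j‖ ^ 2 ≤
      2 * (invSqrt n ^ 2 * A i j ^ 2) + if i = j then 2 * ‖z‖ ^ 2 else 0 := by
  have happly : shiftedMatrix A z i j = ((invSqrt n * A i j : ℝ) : ℂ) - if i = j then z else 0 := by
    by_cases hij : i = j <;> simp [shiftedMatrix, invSqrt, hij]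
  calc ‖shiftedMatrix A z i j‖ ^ 2
      ≤ (‖((invSqrt n * A i j : ℝ) : ℂ)‖ + ‖if i = j then z else 0‖) ^ 2 := by
        rw [happly]
        gcongr
        exact norm_sub_le _ _
    _ ≤ 2 * (‖((invSqrt n * A i j : ℝ) : ℂ)‖ ^ 2 + ‖if i = j then z else 0‖ ^ 2) := add_sq_le
    _ = _ := by
        rw [Complex.norm_real, Real.norm_eq_abs, sq_abs, mul_pow]
        split_ifs <;> simp [mul_add]

theorem inv_mul_sum_norm_sq_shiftedMatrix_le (A : Matrix (Fin n) (Fin n) ℝ) (z : ℂ) :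
    (n : ℝ)⁻¹ * ∑ i, ∑ j, ‖shiftedMatrix A z i j‖ ^ 2 ≤
      2 * (((n : ℝ)⁻¹) ^ 2 * ∑ i, ∑ j, A i j ^ 2) + 2 * ‖z‖ ^ 2 := by
  have hsum : ∑ i, ∑ j, ‖shiftedMatrix A z i j‖ ^ 2 ≤
      2 * ((n : ℝ)⁻¹ * ∑ i, ∑ j, A i j ^ 2) + n * (2 * ‖z‖ ^ 2) := by
    refine (Finset.sum_le_sum fun i _ => Finset.sum_le_sum fun j _ =>
      norm_shiftedMatrix_apply_sq_le A z i j).trans_eq ?_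
    simp [Finset.sum_add_distrib, Finset.mul_sum, invSqrt_sq]
  calc (n : ℝ)⁻¹ * ∑ i, ∑ j, ‖shiftedMatrix A z i j‖ ^ 2
      ≤ (n : ℝ)⁻¹ * (2 * ((n : ℝ)⁻¹ * ∑ i, ∑ j, A i j ^ 2) + n * (2 * ‖z‖ ^ 2)) := by gcongr
    _ = 2 * ((n : ℝ)⁻¹ ^ 2 * ∑ i, ∑ j, A i j ^ 2) + (n : ℝ)⁻¹ * n * (2 * ‖z‖ ^ 2) := by ring
    _ ≤ 2 * ((n : ℝ)⁻¹ ^ 2 * ∑ i, ∑ j, A i j ^ 2) + 1 * (2 * ‖z‖ ^ 2) := by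
        gcongr
        exact inv_mul_le_one
    _ = _ := by rw [one_mul]

end SingularValueLaw

section Limit

theorem measure_setOf_le_le_ofReal_div {Ω : Type*} [MeasurableSpace Ω] {P : Measure Ω}
    [IsFiniteMeasure P] {f : Ω → ℝ} {B c : ℝ} (hf₀ : ∀ ω, 0 ≤ f ω) (hf : Integrable f P)
    (hB : ∫ ω, f ω ∂P ≤ B) (hc : 0 < c) : P {ω | c ≤ f ω} ≤ ENNReal.ofReal (B / c) := by
  rw [← ofReal_measureReal]
  refine ENNReal.ofReal_le_ofReal ((le_div_iff₀' hc).2 ?_)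
  exact (mul_meas_ge_le_integral_of_nonneg (Eventually.of_forall hf₀) hf c).trans hB

theorem tendsto_invSqrt_atTop : Tendsto invSqrt atTop (𝓝 0) :=
  tendsto_inv_atTop_zero.comp (Real.tendsto_sqrt_atTop.comp tendsto_natCast_atTop_atTop)

namespace IsEllipticMatrix

section FixedDimension

variable {Ω : Type*} [MeasurableSpace Ω] {P : Measure Ω} {ρ : ℝ} {M₃ κ : ℝ≥0} {n : ℕ}
  {A : Ω → Matrix (Fin n) (Fin n) ℝ} {v : ℝ} {z : ℂ}

theorem integral_sq_le (hA : IsEllipticMatrix P ρ M₃ κ A) (i j : Fin n) :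
    ∫ ω, A ω i j ^ 2 ∂P ≤ 1 + κ := by
  rcases eq_or_ne i j with rfl | hij
  · exact (hA.second_moment_diag_le i).trans (le_add_of_nonneg_left zero_le_one)
  · exact (hA.variance_offDiag i j hij).trans_le (le_add_of_nonneg_right κ.2)

variable [IsProbabilityMeasure P]

theorem integrable_norm_dysonDefect_sq (hA : IsEllipticMatrix P ρ M₃ κ A) (hρ : |ρ| ≤ 1)
    (hv : 1 ≤ v) (a b : Bool) :
    Integrable (fun ω => ‖dysonDefect ρ z v (blockTrace z v (A ω)) a b‖ ^ 2) P := by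
  refine .of_bound (((measurable_dysonDefect_blockTrace ρ z v a b).comp
    hA.measurable).norm.pow_const 2).aestronglyMeasurable ((‖z‖ + 4 + v) ^ 2)
    (Eventually.of_forall fun ω => ?_)
  rw [norm_pow, norm_norm]
  gcongr
  exact (norm_apply_apply_le _ a b).trans
    (norm_dysonDefect_le hρ z (zero_le_one.trans hv) (norm_blockTrace_le_one hv _))

theorem measure_le_norm_dysonDefect_apply_le (hA : IsEllipticMatrix P ρ M₃ κ A) (hn : n ≠ 0)
    (hρ : |ρ| ≤ 1) (hv : 1 ≤ v) (a b : Bool) {δ : ℝ} (hδ : 0 < δ) :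
    P {ω | δ ≤ ‖dysonDefect ρ z v (blockTrace z v (A ω)) a b‖} ≤
      ENNReal.ofReal ((‖z‖ + 4 + v) * (240 * M₃ + κ + 37) * invSqrt n / δ ^ 2) := by
  refine (measure_mono fun ω hω => ?_).trans
    (measure_setOf_le_le_ofReal_div (fun ω => sq_nonneg _)
      (hA.integrable_norm_dysonDefect_sq hρ hv a b)
      (hA.integral_norm_dysonDefect_sq_le hn hρ hv a b) (pow_pos hδ 2))
  exact pow_le_pow_left₀ hδ.le hω 2

theorem memLp_two (hA : IsEllipticMatrix P ρ M₃ κ A) (i j : Fin n) :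
    MemLp (fun ω => A ω i j) 2 P := by
  rcases eq_or_ne i j with rfl | hij
  · exact hA.memLp_diag i
  · exact (hA.memLp_offDiag i j hij).mono_exponent (by norm_num)

theorem integrable_sum_sum_sq (hA : IsEllipticMatrix P ρ M₃ κ A) :
    Integrable (fun ω => ∑ i, ∑ j, A ω i j ^ 2) P :=
  integrable_finsetSum _ fun i _ => integrable_finsetSum _ fun j _ =>
    (hA.memLp_two i j).integrable_sq

theorem inv_sq_mul_integral_sum_sum_sq_le (hA : IsEllipticMatrix P ρ M₃ κ A) :
    (n : ℝ)⁻¹ ^ 2 * ∫ ω, ∑ i, ∑ j, A ω i j ^ 2 ∂P ≤ 1 + κ := by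
  have hsq (i j : Fin n) : Integrable (fun ω => A ω i j ^ 2) P := (hA.memLp_two i j).integrable_sq
  have hn : (n : ℝ)⁻¹ * n ≤ 1 := inv_mul_le_one
  calc (n : ℝ)⁻¹ ^ 2 * ∫ ω, ∑ i, ∑ j, A ω i j ^ 2 ∂P
      = (n : ℝ)⁻¹ ^ 2 * ∑ i, ∑ j, ∫ ω, A ω i j ^ 2 ∂P := by
        rw [integral_finsetSum _ fun i _ => integrable_finsetSum _ fun j _ => hsq i j]
        simp only [integral_finsetSum _ fun j _ => hsq _ j]
    _ ≤ (n : ℝ)⁻¹ ^ 2 * ∑ _i : Fin n, ∑ _j : Fin n, (1 + (κ : ℝ)) := by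
        gcongr
        exact hA.integral_sq_le _ _
    _ = ((n : ℝ)⁻¹ * n) ^ 2 * (1 + κ) := by
        simp only [Finset.sum_const, Finset.card_univ, Fintype.card_fin, nsmul_eq_mul]
        ring
    _ ≤ 1 + κ := mul_le_of_le_one_left (by positivity) (pow_le_one₀ (by positivity) hn)

theorem measure_singularValueLaw_notMem_secondMomentLE_le (hA : IsEllipticMatrix P ρ M₃ κ A)
    (z : ℂ) {C : ℝ≥0} (hC : 0 < C) :
    P {ω | singularValueLaw (shiftedMatrix (A ω) z) ∉ secondMomentLE C} ≤
      ENNReal.ofReal ((2 * (1 + κ) + 2 * ‖z‖ ^ 2) / C) := by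
  have hint : Integrable (fun ω => 2 * ((n : ℝ)⁻¹ ^ 2 * ∑ i, ∑ j, A ω i j ^ 2)) P :=
    (hA.integrable_sum_sum_sq.const_mul _).const_mul _
  refine (measure_mono fun ω hω => ?_).trans (measure_setOf_le_le_ofReal_div
    (f := fun ω => 2 * ((n : ℝ)⁻¹ ^ 2 * ∑ i, ∑ j, A ω i j ^ 2) + 2 * ‖z‖ ^ 2)
    (fun ω => by positivity) (hint.add (integrable_const _)) ?_ (NNReal.coe_pos.2 hC))
  · by_contra hlt
    exact hω (singularValueLaw_mem_secondMomentLE _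
      ((inv_mul_sum_norm_sq_shiftedMatrix_le (A ω) z).trans (not_le.1 hlt).le))
  · rw [integral_add hint (integrable_const _), integral_const_mul, integral_const_mul]
    simpa using hA.inv_sq_mul_integral_sum_sum_sq_le

end FixedDimension

variable {Ω : ℕ → Type*} [∀ n, MeasurableSpace (Ω n)] {P : ∀ n, Measure (Ω n)}
  [∀ n, IsProbabilityMeasure (P n)] {ρ : ℝ} {M₃ κ : ℝ≥0}
  {A : ∀ n, Ω n → Matrix (Fin n) (Fin n) ℝ} {v : ℝ} {z : ℂ}

theorem exists_forall_measure_singularValueLaw_notMem_secondMomentLE_le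
    (hA : ∀ n, IsEllipticMatrix (P n) ρ M₃ κ (A n)) (z : ℂ) {η : ℝ≥0∞} (hη : 0 < η) :
    ∃ C : ℝ≥0, ∀ n,
      P n {ω | singularValueLaw (shiftedMatrix (A n ω) z) ∉ secondMomentLE C} ≤ η := by
  obtain ⟨r, hr₀, hrη⟩ := ENNReal.lt_iff_exists_nnreal_btwn.1 hη
  have hr : 0 < r := ENNReal.coe_pos.1 hr₀
  have hB : 0 < 2 * (1 + κ) + 2 * ‖z‖₊ ^ 2 := by positivity
  refine ⟨(2 * (1 + κ) + 2 * ‖z‖₊ ^ 2) / r, fun n => ?_⟩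
  refine ((hA n).measure_singularValueLaw_notMem_secondMomentLE_le z (div_pos hB hr)).trans
    (le_trans (le_of_eq ?_) hrη.le)
  rw [← ENNReal.ofReal_coe_nnreal]
  congr 1
  have hB' : 2 * (1 + (κ : ℝ)) + 2 * ‖z‖ ^ 2 ≠ 0 := by positivity
  push_cast
  exact div_div_cancel₀ hB'

theorem tendsto_measure_le_norm_dysonDefect_apply
    (hA : ∀ n, IsEllipticMatrix (P n) ρ M₃ κ (A n)) (hρ : |ρ| ≤ 1) (hv : 1 ≤ v) (a b : Bool)
    {δ : ℝ} (hδ : 0 < δ) :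
    Tendsto (fun n => P n {ω | δ ≤ ‖dysonDefect ρ z v (blockTrace z v (A n ω)) a b‖})
      atTop (𝓝 0) := by
  have hbound : Tendsto (fun n => ENNReal.ofReal
      ((‖z‖ + 4 + v) * (240 * M₃ + κ + 37) * invSqrt n / δ ^ 2)) atTop (𝓝 0) := by
    simpa using ENNReal.tendsto_ofReal ((tendsto_invSqrt_atTop.const_mul
      ((‖z‖ + 4 + v) * (240 * M₃ + κ + 37))).div_const (δ ^ 2))
  refine tendsto_of_tendsto_of_tendsto_of_le_of_le' tendsto_const_nhds hbound
    (Eventually.of_forall fun _ => zero_le) ?_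
  filter_upwards [eventually_ne_atTop 0] with n hn
  exact (hA n).measure_le_norm_dysonDefect_apply_le hn hρ hv a b hδ

theorem tendsto_measure_lt_norm_dysonDefect (hA : ∀ n, IsEllipticMatrix (P n) ρ M₃ κ (A n))
    (hρ : |ρ| ≤ 1) (hv : 1 ≤ v) {δ : ℝ} (hδ : 0 < δ) :
    Tendsto (fun n => P n {ω | δ < ‖dysonDefect ρ z v (blockTrace z v (A n ω))‖})
      atTop (𝓝 0) := by
  have hsum : Tendsto (fun n => ∑ p : Bool × Bool,
      P n {ω | δ ≤ ‖dysonDefect ρ z v (blockTrace z v (A n ω)) p.1 p.2‖}) atTop (𝓝 0) := by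
    simpa using tendsto_finsetSum Finset.univ fun (p : Bool × Bool) _ =>
      tendsto_measure_le_norm_dysonDefect_apply (z := z) hA hρ hv p.1 p.2 hδ
  refine tendsto_of_tendsto_of_tendsto_of_le_of_le tendsto_const_nhds hsum (fun _ => zero_le)
    fun n => (measure_mono fun ω hω => ?_).trans (measure_iUnion_fintype_le _ _)
  by_contra hcon
  simp only [Set.mem_iUnion, Set.mem_ofPred_eq, not_exists, not_le] at hcon
  exact not_le.2 hω (norm_le_of_forall_apply_apply_le hδ.le fun a b => (hcon (a, b)).le)

end IsEllipticMatrix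

/-- The limit of the transforms `∫ (x² + t)⁻¹` of the laws of the singular values of
`n^{-1/2} A - z`, for `t > (2 * (‖z‖ + 4)) ^ 2`. -/
noncomputable def limitTransform (ρ : ℝ) (z : ℂ) (t : ℝ) : ℝ :=
  (dysonSolution ρ z √t true true).im / √t

theorem two_mul_norm_add_four_le_sqrt {z : ℂ} {t : ℝ} (ht : (2 * (‖z‖ + 4)) ^ 2 < t) :
    2 * (‖z‖ + 4) ≤ √t :=
  Real.le_sqrt_of_sq_le ht.le

theorem one_le_sqrt_of_lt {z : ℂ} {t : ℝ} (ht : (2 * (‖z‖ + 4)) ^ 2 < t) : 1 ≤ √t := by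
  linarith [two_mul_norm_add_four_le_sqrt ht, norm_nonneg z]

theorem abs_invSqTransform_sub_limitTransform_le {n : ℕ} {ρ : ℝ} {z : ℂ} {t : ℝ} (hn : n ≠ 0)
    (hρ : |ρ| ≤ 1) (ht : (2 * (‖z‖ + 4)) ^ 2 < t) (A : Matrix (Fin n) (Fin n) ℝ) :
    |invSqTransform (singularValueLaw (shiftedMatrix A z)) t - limitTransform ρ z t| ≤
      ‖dysonDefect ρ z √t (blockTrace z √t A)‖ := by
  have hv := two_mul_norm_add_four_le_sqrt ht
  have hv₁ := one_le_sqrt_of_lt ht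
  have hv₀ : 0 < √t := zero_lt_one.trans_le hv₁
  have htransform := invSqTransform_singularValueLaw_shiftedMatrix hn A z hv₀.ne'
  rw [Real.sq_sqrt (Real.sqrt_pos.1 hv₀).le] at htransform
  set g := blockTrace z √t A
  set g' := dysonSolution ρ z √t with hg'
  calc |invSqTransform (singularValueLaw (shiftedMatrix A z)) t - limitTransform ρ z t|
      = |((g - g') true true).im| / √t := by
        rw [htransform, limitTransform, ← hg', ← sub_div, ← Complex.sub_im, abs_div,
          abs_of_pos hv₀]
        rfl
    _ ≤ |((g - g') true true).im| := div_le_self (abs_nonneg _) hv₁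
    _ ≤ ‖g - g'‖ := (Complex.abs_im_le_norm _).trans (norm_apply_apply_le _ _ _)
    _ ≤ ‖dysonDefect ρ z √t g‖ :=
        (isDysonSolution_dysonSolution hρ z hv).norm_sub_le_norm_dysonDefect hρ hv
          (norm_blockTrace_le_one hv₁ A)

/-- The limiting law of the singular values on `[0, ∞)`, characterized by its transform. It exists
as soon as there is a sequence of elliptic matrices with correlation `ρ`, and is a junk value
otherwise. -/
noncomputable def limitLaw (ρ : ℝ) (z : ℂ) : ProbabilityMeasure ℝ≥0 :=
  Classical.epsilon fun ν => ∀ t, (2 * (‖z‖ + 4)) ^ 2 < t →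
    invSqTransform ν t = limitTransform ρ z t

/-- The distribution function on `ℝ` of the limiting law of the singular values. -/
noncomputable def limitDistribution (ρ : ℝ) (z : ℂ) : StieltjesFunction ℝ :=
  cdf ((limitLaw ρ z : Measure ℝ≥0).map ((↑) : ℝ≥0 → ℝ))

theorem measure_limitDistribution (ρ : ℝ) (z : ℂ) :
    (limitDistribution ρ z).measure = (limitLaw ρ z : Measure ℝ≥0).map ((↑) : ℝ≥0 → ℝ) :=
  have : IsProbabilityMeasure ((limitLaw ρ z : Measure ℝ≥0).map ((↑) : ℝ≥0 → ℝ)) :=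
    Measure.isProbabilityMeasure_map measurable_coe_nnreal_real.aemeasurable
  measure_cdf _

theorem isDistributionFunction_limitDistribution (ρ : ℝ) (z : ℂ) :
    IsDistributionFunction (limitDistribution ρ z) :=
  ⟨tendsto_cdf_atBot _, tendsto_cdf_atTop _⟩

namespace IsEllipticMatrix

variable {Ω : ℕ → Type*} [∀ n, MeasurableSpace (Ω n)] {P : ∀ n, Measure (Ω n)}
  [∀ n, IsProbabilityMeasure (P n)] {ρ : ℝ} {M₃ κ : ℝ≥0}
  {A : ∀ n, Ω n → Matrix (Fin n) (Fin n) ℝ} {z : ℂ}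

theorem tendsto_measure_le_abs_invSqTransform_sub
    (hA : ∀ n, IsEllipticMatrix (P n) ρ M₃ κ (A n)) (hρ : |ρ| ≤ 1) {t : ℝ}
    (ht : (2 * (‖z‖ + 4)) ^ 2 < t) {δ : ℝ} (hδ : 0 < δ) :
    Tendsto (fun n => P n {ω | δ ≤ |invSqTransform
      (singularValueLaw (shiftedMatrix (A n ω) z)) t - limitTransform ρ z t|}) atTop (𝓝 0) := by
  refine tendsto_of_tendsto_of_tendsto_of_le_of_le' tendsto_const_nhds
    (tendsto_measure_lt_norm_dysonDefect (z := z) hA hρ (one_le_sqrt_of_lt ht) (half_pos hδ))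
    (Eventually.of_forall fun _ => zero_le) ?_
  filter_upwards [eventually_ne_atTop 0] with n hn
  exact measure_mono fun ω hω => (half_lt_self hδ).trans_le
    (le_trans hω (abs_invSqTransform_sub_limitTransform_le hn hρ ht (A n ω)))

theorem tendsto_measure_lt_norm_integral_singularValueLaw_sub
    (hA : ∀ n, IsEllipticMatrix (P n) ρ M₃ κ (A n)) (hρ : |ρ| ≤ 1) (z : ℂ) (f : ℝ≥0 →ᵇ ℂ)
    {ε : ℝ} (hε : 0 < ε) :
    Tendsto (fun n => P n {ω | ε <
      ‖∫ x, f x ∂(singularValueLaw (shiftedMatrix (A n ω) z) : Measure ℝ≥0) -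
        ∫ x, f x ∂(limitLaw ρ z : Measure ℝ≥0)‖}) atTop (𝓝 0) := by
  have ht₀ : 0 < (2 * (‖z‖ + 4)) ^ 2 := by positivity
  have htight (η : ℝ≥0∞) (hη : 0 < η) :=
    exists_forall_measure_singularValueLaw_notMem_secondMomentLE_le hA z hη
  have hconv (t : ℝ) (ht : (2 * (‖z‖ + 4)) ^ 2 < t) (δ : ℝ) (hδ : 0 < δ) :=
    tendsto_measure_le_abs_invSqTransform_sub hA hρ ht hδ
  exact tendsto_measure_lt_norm_integral_sub_of_invSqTransform ht₀ htight hconv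
    (Classical.epsilon_spec (exists_invSqTransform_eq ht₀ htight hconv)) f hε

end IsEllipticMatrix

theorem mainTheorem4_general (ρ : ℝ) (hρ : |ρ| ≤ 1) :
    ∃ F : ℂ → StieltjesFunction ℝ, (∀ z, IsDistributionFunction (F z)) ∧
      ∀ (Ω : ℕ → Type*) [∀ n, MeasurableSpace (Ω n)] (P : ∀ n, Measure (Ω n))
        [∀ n, IsProbabilityMeasure (P n)] (M₃ κ : ℝ≥0)
        (A : ∀ n, Ω n → Matrix (Fin n) (Fin n) ℝ),
        (∀ n, IsEllipticMatrix (P n) ρ M₃ κ (A n)) →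
        ∀ (z : ℂ) (f : ℝ →ᵇ ℂ) (ε : ℝ), 0 < ε →
          Tendsto (fun n : ℕ => P n {ω | ε <
            ‖(∫ x, f x ∂(singularValueMeasure (shiftedMatrix (A n ω) z))) -
              ∫ x, f x ∂(F z).measure‖}) atTop (𝓝 0) := by
  refine ⟨limitDistribution ρ, isDistributionFunction_limitDistribution ρ, ?_⟩
  intro Ω _ P _ M₃ κ A hA z f ε hε
  have hmap (μ : Measure ℝ≥0) : ∫ x, f x ∂(μ.map ((↑) : ℝ≥0 → ℝ)) = ∫ x : ℝ≥0, f x ∂μ :=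
    integral_map measurable_coe_nnreal_real.aemeasurable
      f.continuous.measurable.aestronglyMeasurable
  refine (IsEllipticMatrix.tendsto_measure_lt_norm_integral_singularValueLaw_sub hA hρ z
    (f.compContinuous ⟨((↑) : ℝ≥0 → ℝ), NNReal.continuous_coe⟩) hε).congr' ?_
  filter_upwards [eventually_ne_atTop 0] with n hn
  simp only [← map_singularValueLaw hn, measure_limitDistribution, hmap]
  rfl

end Limit

theorem mainTheorem4 (ρ : ℝ) (hρ : |ρ| ≤ 1) :
    ∃ F : ℂ → StieltjesFunction ℝ, (∀ z, IsDistributionFunction (F z)) ∧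
      ∀ (Ω : Type*) [MeasurableSpace Ω] (P : Measure Ω) [IsProbabilityMeasure P] (M₄ : ℝ)
        (X : (n : ℕ) → Fin n → Fin n → Ω → ℝ), ConditionC0 P ρ M₄ X →
        ∀ᵐ z : ℂ, ∀ (f : ℝ →ᵇ ℂ) (ε : ℝ), 0 < ε →
          Tendsto (fun n : ℕ => P {ω | ε <
            ‖(∫ x, f x ∂(singularValueMeasure
                (shiftedMatrix (Matrix.of fun i j => X n i j ω) z))) -
              ∫ x, f x ∂(F z).measure‖}) atTop (𝓝 0) := by
  obtain ⟨F, hF, hlim⟩ := mainTheorem4_general ρ hρ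
  exact ⟨F, hF, fun Ω _ P _ M₄ X hX => Eventually.of_forall
    (hlim (fun _ => Ω) (fun _ => P) _ _ _ hX.isEllipticMatrix)⟩
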